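/- Let $\Omega=[0,1]$ with Lebesgue measure, $\alpha,\beta\in[0,1)$, $\kappa>0$, $0<D_0<\pi$ and $T\in(0,\infty]$. Put $\psi(x,y)=|x-y|^{-\beta}$ and $h(z)=\sin z/|z|_o^{\alpha}$ for $z\notin 2\pi\mathbb Z$, $h(z)=0$ for $z\in 2\pi\mathbb Z$, where $|z|_o=|\bar z|$ with $\bar z\equiv z \bmod 2\pi$, $\bar z\in(-\pi,\pi]$. For $u:\Omega\to\mathbb R$ let $\mathcal D(u)=\operatorname{ess\,sup}_{x,y\in\Omega}|u(x)-u(y)|$. For $N\ge1$ let $I_1=[0,1/N]$, $I_i=((i-1)/N,i/N]$ $(2\le i\le N)$, and let $\psi^N$ be the step kernel equal on $I_i\times I_k$ to the average of $\psi$ over $I_i\times I_k$. Given $W:\Omega^2\to[0,\infty)$, $\nu:\Omega\to\mathbb R$ and $\theta^{\mathrm{in}}\in L^2(\Omega)$, a solution on $[0,T)$ of $$\partial_t\theta(t,x)=\nu(x)+\kappa\int_\Omega W(x,y)\,h(\theta(t,y)-\theta(t,x))\,dy,\qquad \theta(0,\cdot)=\theta^{\mathrm{in}}, \tag{$*$}$$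 is a real-valued $\theta\in C([0,T);L^2(\Omega))$ with $\theta(0)=\theta^{\mathrm{in}}$ that is differentiable in $L^2(\Omega)$ at every $t\in(0,T)$ and satisfies the equation there. Then there is a constant $\bar C_T>0$, depending only on $\alpha,\beta,\kappa,D_0$ and $T$, such that the following holds. Let $\nu_\star\in\mathbb R$, let $\theta^{\mathrm{in}}\in L^2(\Omega)$ with $\mathcal D(\theta^{\mathrm{in}})\le D_0$, and for each $N$ let $\theta^{\mathrm{in},N}$ be a real function, constant on each $I_i$ $(1\le i\le N)$, with $\theta^{\mathrm{in},N}\to\theta^{\mathrm{in}}$ in $L^2(\Omega)$; if $T=\infty$, assume also $\mathcal D(\theta^{\mathrm{in},N})\le D_0$ for all $N\ge1$ (for cell averages of $\theta^{\mathrm{in}}$ this is automatic). Let $\theta$ be a solution of $(*)$ on $[0,T)$ with $W=\psi$, $\nu\equiv\nu_\star$ and initial datum $\theta^{\mathrm{in}}$, and for each $N\ge1$ let $\theta^N$ be a solution of $(*)$ on $[0,T)$ with $W=\psi^N$, $\nu\equiv\nu_\star$ and initial datum $\theta^{\mathrm{in},N}$. Then for every $N\ge1$ $$\sup_{0\le t<T}\|\theta^N(t)-\theta(t)\|_{L^2(\Omega)}^2\le\bar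 C_T\Big(\|\theta^{\mathrm{in},N}-\theta^{\mathrm{in}}\|_{L^2(\Omega)}^2+\|\psi^N-\psi\|_{L^1(\Omega^2)}\Big),$$ and $\sup_{0\le t<T}\|\theta^N(t)-\theta(t)\|_{L^2(\Omega)}\to0$ as $N\to\infty$. (For $T=\infty$ this is the uniform-in-time graph limit.) -/

import Mathlib

open MeasureTheory Filter Topology
open scoped ENNReal

noncomputable section

namespace SCKM

/-- Lebesgue measure on the domain `Ω = [0, 1]`. -/
abbrev unitMeasure : Measure ℝ := volume.restrict (Set.Icc 0 1)

/-- The Hilbert space `L²(Ω)`. -/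
abbrev L2 : Type := Lp ℝ 2 unitMeasure

/-- `|z|_o`: the absolute value of the representative of `z` modulo `2π` in `(-π, π]`. -/
def circAbs (z : ℝ) : ℝ := |toIocMod Real.two_pi_pos (-Real.pi) z|

/-- The singular coupling function `h(z) = sin z / |z|_o ^ α`; it vanishes at the multiples of
`2π`, because there the numerator is zero. -/
def coupling (α z : ℝ) : ℝ := Real.sin z / circAbs z ^ α

/-- The communication weight `ψ(x, y) = 1 / |x - y| ^ β` (its value on the diagonal, a null set,
plays no role). -/
def weight (β x y : ℝ) : ℝ := 1 / |x - y| ^ β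

/-- The cells of the partition of `[0, 1]` into `N` intervals of length `1 / N`, numbered from `0`:
the first one is `[0, 1 / N]`, the later ones are `(i / N, (i + 1) / N]`. -/
def cell (N : ℕ) (i : Fin N) : Set ℝ :=
  if (i : ℕ) = 0 then Set.Icc 0 (1 / (N : ℝ))
  else Set.Ioc ((i : ℝ) / N) (((i : ℝ) + 1) / N)

/-- The step function with value `a i` on the `i`-th cell. -/
def stepFun {N : ℕ} (a : Fin N → ℝ) (x : ℝ) : ℝ :=
  ∑ i, (cell N i).indicator (fun _ => a i) x

/-- The step kernel `W^N` of a kernel `W`: on the product of the `i`-th and the `k`-th cell it is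
the average of `W` over that product. -/
def stepKernel (N : ℕ) (W : ℝ → ℝ → ℝ) (x y : ℝ) : ℝ :=
  ∑ i, ∑ k, (cell N i ×ˢ cell N k).indicator
    (fun _ => ⨍ p in cell N i ×ˢ cell N k, W p.1 p.2) (x, y)

theorem measurableSet_cell (N : ℕ) (i : Fin N) : MeasurableSet (cell N i) := by
  unfold cell
  split_ifs
  · exact measurableSet_Icc
  · exact measurableSet_Ioc

theorem memLp_stepFun {N : ℕ} (a : Fin N → ℝ) : MemLp (stepFun a) 2 unitMeasure := by
  unfold stepFun
  exact memLp_finsetSum _ fun i _ => (memLp_const (a i)).indicator (measurableSet_cell N i)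

/-- The step function with value `a i` on the `i`-th cell, as an element of `L²(Ω)`. -/
def stepL2 {N : ℕ} (a : Fin N → ℝ) : L2 := (memLp_stepFun a).toLp (stepFun a)

/-- The (essential) diameter `𝒟(u) = ess sup_{(x, y) ∈ Ω²} |u(x) - u(y)|`. -/
def diameter (u : ℝ → ℝ) : ℝ≥0∞ :=
  essSup (fun p : ℝ × ℝ => ‖u p.1 - u p.2‖ₑ) (unitMeasure.prod unitMeasure)

/-- The `L¹(Ω²)` distance of two kernels. -/
def kernelDist (V W : ℝ → ℝ → ℝ) : ℝ :=
  ∫ p : ℝ × ℝ, |V p.1 p.2 - W p.1 p.2| ∂(unitMeasure.prod unitMeasure)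

/-- The time interval `[0, T)`, where `T` may be `∞`. -/
def timeInterval (T : ℝ≥0∞) : Set ℝ := {t | 0 ≤ t ∧ ENNReal.ofReal t < T}

/-- The right-hand side `x ↦ ν(x) + κ ∫_Ω W(x, y) h(u(y) - u(x)) dy`. -/
def velocity (α κ : ℝ) (W : ℝ → ℝ → ℝ) (ν u : ℝ → ℝ) (x : ℝ) : ℝ :=
  ν x + κ * ∫ y, W x y * coupling α (u y - u x) ∂unitMeasure

/-- `θ ∈ C([0, T); L²(Ω))` solves the Cauchy problem
`∂ₜθ(t, x) = ν(x) + κ ∫_Ω W(x, y) h(θ(t, y) - θ(t, x)) dy` for `0 < t < T`, `θ(0, ·) = θin`.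
The equation is an equation in `L²(Ω)`. -/
structure IsSolution (α κ : ℝ) (W : ℝ → ℝ → ℝ) (ν : ℝ → ℝ) (θin : L2) (T : ℝ≥0∞)
    (θ : ℝ → L2) : Prop where
  continuousOn : ContinuousOn θ (timeInterval T)
  initial : θ 0 = θin
  equation : ∀ t ∈ timeInterval T, 0 < t → ∃ v : L2,
    (v : ℝ → ℝ) =ᵐ[unitMeasure] velocity α κ W ν (θ t) ∧ HasDerivAt θ v t

end SCKM

end

/-! Two one-sided bounds for the coupling h carry the proof. On the whole line h(z) + (π²/2) z is
increasing, because for α > 0 the singularity at 0 only makes the slope of h large and positive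
(`coupling_oneSidedLipschitz`). On |z| ≤ d with d² ≤ 1 - α, h is strongly monotone
(`coupling_strongMono`).

The kernels are symmetric and h is odd, so testing the difference of two solutions against the
difference of their velocities gives -κ/2 times a double integral of (V h(a) - W h(b)) (a - b), with
a and b the two phase differences. Only row integrals of the kernels are needed to bound it.
Separating |a - b| ≤ 1 from |a - b| > 1 lets the kernel error enter through |V - W| alone, which is
why the L¹ distance suffices. Gronwall then gives stability with an exponential constant,
`IsSolution.norm_sub_sq_le`, and this settles T < ∞.

For T = ∞ the diameter of a solution decays exponentially when it starts below π
(`IsSolution.diameter_decay`). Solutions are only L²-valued, so extremal points cannot be followed.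
Instead, the deviation from the mean, magnified by e^{ct}, is shown to remain in a fixed interval:
its squared L² distance to the functions with values in that interval starts at 0 and satisfies a
linear differential inequality. After a waiting time fixed by α, κ and the initial diameter bound,
both solutions lie where h is strongly monotone. There the variance of their difference contracts up
to the kernel error, and the mean of the difference is conserved
(`IsSolution.norm_sub_sq_le_of_small`). `exists_uniform_stability` joins the two regimes.

Averaging over cells preserves symmetry, the lower bound 1 and the row bound, so the constants do
not depend on N. The averaged kernels converge in L¹ by density of continuous functions. -/

noncomputable section

namespace SCKM

/-! ### Elementary properties of the coupling function -/

theorem abs_toIocMod_le_pi (z : ℝ) : |toIocMod Real.two_pi_pos (-Real.pi) z| ≤ Real.pi := by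
  have h := toIocMod_mem_Ioc Real.two_pi_pos (-Real.pi) z
  rw [abs_le]
  constructor <;> linarith [h.1, h.2]

theorem circAbs_nonneg (z : ℝ) : 0 ≤ circAbs z := abs_nonneg _

theorem norm_addCircle_eq_abs {z : ℝ} (hz : |z| ≤ Real.pi) :
    ‖(z : AddCircle (2 * Real.pi))‖ = |z| := by
  rw [AddCircle.norm_coe_eq_abs_iff _ Real.two_pi_pos.ne', abs_of_pos Real.two_pi_pos]
  linarith

/-- Passing to the norm of the additive circle makes evenness and measurability immediate. -/
theorem circAbs_eq_norm (z : ℝ) : circAbs z = ‖(z : AddCircle (2 * Real.pi))‖ := by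
  have h1 : (z : AddCircle (2 * Real.pi)) =
      (toIocMod Real.two_pi_pos (-Real.pi) z : ℝ) := by
    rw [toIocMod, AddCircle.coe_sub, AddCircle.coe_zsmul, AddCircle.coe_period, smul_zero, sub_zero]
  rw [h1, norm_addCircle_eq_abs (abs_toIocMod_le_pi z), circAbs]

theorem circAbs_eq_abs {z : ℝ} (hz : |z| ≤ Real.pi) : circAbs z = |z| := by
  rw [circAbs_eq_norm, norm_addCircle_eq_abs hz]

theorem circAbs_neg (z : ℝ) : circAbs (-z) = circAbs z := by
  simp [circAbs_eq_norm]

theorem measurable_circAbs : Measurable circAbs := by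
  have : circAbs = fun z : ℝ => ‖(z : AddCircle (2 * Real.pi))‖ := funext circAbs_eq_norm
  rw [this]
  exact (continuous_norm.comp (AddCircle.continuous_mk' _)).measurable

theorem measurable_coupling (α : ℝ) : Measurable (coupling α) :=
  Real.measurable_sin.div (measurable_circAbs.pow_const α)

theorem coupling_periodic (α : ℝ) : Function.Periodic (coupling α) (2 * Real.pi) := by
  intro z
  simp [coupling, circAbs, Real.sin_add_two_pi]

theorem coupling_neg (α z : ℝ) : coupling α (-z) = -coupling α z := by
  simp [coupling, circAbs_neg, neg_div]

theorem coupling_zero (α : ℝ) : coupling α 0 = 0 := by simp [coupling]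

theorem coupling_pi (α : ℝ) : coupling α Real.pi = 0 := by simp [coupling]

theorem abs_sin_le_circAbs (z : ℝ) : |Real.sin z| ≤ circAbs z := by
  have : Real.sin z = Real.sin (toIocMod Real.two_pi_pos (-Real.pi) z) := by
    rw [toIocMod, zsmul_eq_mul, Real.sin_sub_int_mul_two_pi]
  rw [this]
  exact Real.abs_sin_le_abs

/-- Compare the numerator with `circAbs z` when that is at most 1, and with 1 otherwise. The
argument even gives the bound 1; π is a harmless overestimate. -/
theorem abs_coupling_le {α : ℝ} (hα : 0 ≤ α ∧ α < 1) (z : ℝ) : |coupling α z| ≤ Real.pi := by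
  have hpi := Real.pi_gt_three
  rw [coupling, abs_div, abs_of_nonneg (Real.rpow_nonneg (circAbs_nonneg z) α)]
  rcases (circAbs_nonneg z).eq_or_lt with h0 | h0
  · have := abs_sin_le_circAbs z
    rw [← h0] at this
    have h2 : |Real.sin z| = 0 := le_antisymm this (abs_nonneg _)
    rw [h2, zero_div]
    linarith
  · rw [div_le_iff₀ (Real.rpow_pos_of_pos h0 α)]
    by_cases h1 : circAbs z ≤ 1
    · have h3 : circAbs z ≤ circAbs z ^ α := by
        simpa using Real.rpow_le_rpow_of_exponent_ge h0 h1 hα.2.le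
      nlinarith [abs_sin_le_circAbs z]
    · have h3 : 1 ≤ circAbs z ^ α := Real.one_le_rpow (by linarith) hα.1
      nlinarith [abs_sin_le_circAbs z, Real.abs_sin_le_one z]

theorem coupling_of_mem {α z : ℝ} (hz : 0 < z) (hz' : z ≤ Real.pi) :
    coupling α z = Real.sin z * z ^ (-α) := by
  rw [coupling, circAbs_eq_abs (by rw [abs_of_pos hz]; exact hz'), abs_of_pos hz,
    Real.rpow_neg hz.le, div_eq_mul_inv]

theorem coupling_nonneg {α z : ℝ} (hz : 0 ≤ z) (hz' : z ≤ Real.pi) : 0 ≤ coupling α z :=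
  div_nonneg (Real.sin_nonneg_of_nonneg_of_le_pi hz hz') (Real.rpow_nonneg (circAbs_nonneg z) α)

/-! ### One-sided bounds on the slope of the coupling -/

theorem hasDerivAt_sin_mul_rpow {α c z : ℝ} (hz : 0 < z) :
    HasDerivAt (fun z => Real.sin z * z ^ (-α) - c * z)
      (z ^ (-α) * (Real.cos z - α * (Real.sin z / z)) - c) z := by
  have h := ((Real.hasDerivAt_sin z).mul (Real.hasDerivAt_rpow_const (p := -α)
    (Or.inl hz.ne'))).sub ((hasDerivAt_id z).const_mul c)
  refine h.congr_deriv ?_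
  rw [Real.rpow_sub_one hz.ne']
  ring

theorem le_deriv_bracket {α z : ℝ} (hα : 0 ≤ α) (hz : 0 < z) :
    1 - α - z ^ 2 / 2 ≤ Real.cos z - α * (Real.sin z / z) := by
  have h1 : Real.sin z / z ≤ 1 := by
    rw [div_le_one hz]; exact Real.sin_le hz.le
  nlinarith [Real.one_sub_sq_div_two_le_cos (x := z)]

/-- The derivative is used only to the right of 0, since h may fail to be differentiable at 0.
Oddness bridges that point in `monotoneOn_of_odd`. -/
theorem monotoneOn_coupling_sub {α c d : ℝ} (hd : d ≤ Real.pi)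
    (h : ∀ z, 0 < z → z < d → c ≤ z ^ (-α) * (Real.cos z - α * (Real.sin z / z))) :
    MonotoneOn (fun z => coupling α z - c * z) (Set.Ioc 0 d) := by
  have h1 : MonotoneOn (fun z => Real.sin z * z ^ (-α) - c * z) (Set.Ioc 0 d) := by
    refine monotoneOn_of_deriv_nonneg (convex_Ioc 0 d) ?_ ?_ ?_
    · exact fun z hz => (hasDerivAt_sin_mul_rpow hz.1).continuousAt.continuousWithinAt
    · intro z hz
      rw [interior_Ioc] at hz
      exact (hasDerivAt_sin_mul_rpow hz.1).differentiableAt.differentiableWithinAt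
    · intro z hz
      rw [interior_Ioc] at hz
      rw [(hasDerivAt_sin_mul_rpow hz.1).deriv]
      linarith [h z hz.1 hz.2]
  refine h1.congr fun z hz => ?_
  simp only [coupling_of_mem hz.1 (hz.2.trans hd)]

/-- An odd function that is nonnegative and monotone to the right of `0` is monotone. -/
theorem monotoneOn_of_odd {g : ℝ → ℝ} {d : ℝ} (hodd : ∀ z, g (-z) = -g z)
    (hnn : ∀ z, 0 ≤ z → z ≤ d → 0 ≤ g z) (hg : MonotoneOn g (Set.Ioc 0 d)) :
    MonotoneOn g (Set.Icc (-d) d) := by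
  intro a ha b hb hab
  rcases lt_or_ge 0 a with h | h
  · exact hg ⟨h, ha.2⟩ ⟨h.trans_le hab, hb.2⟩ hab
  rcases lt_or_ge b 0 with h' | h'
  · have := hg (a := -b) ⟨by linarith, by linarith [hb.1]⟩ (b := -a)
      ⟨by linarith, by linarith [ha.1]⟩ (by linarith)
    rw [hodd, hodd] at this
    linarith
  · have h1 := hnn b h' hb.2
    have h2 := hnn (-a) (by linarith) (by linarith [ha.1])
    rw [hodd] at h2
    linarith

/-- The derivative of h at z > 0 is at least z^(-α) (1 - α) - z^(2-α)/2. The first term is positive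
however singular it is, and z^(2-α) ≤ π² on (0, π]. -/
theorem coupling_sub_ge_near {α : ℝ} (hα : 0 ≤ α ∧ α < 1) {a b : ℝ} (hba : b ≤ a)
    (hb : -Real.pi ≤ b) (ha : a ≤ Real.pi) :
    -(Real.pi ^ 2 / 2) * (a - b) ≤ coupling α a - coupling α b := by
  have hpi := Real.pi_gt_three
  have h1 : MonotoneOn (fun z => coupling α z - -(Real.pi ^ 2 / 2) * z) (Set.Ioc 0 Real.pi) := by
    refine monotoneOn_coupling_sub le_rfl fun z hz hz' => ?_
    have h2 := le_deriv_bracket hα.1 hz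
    have h3 : 0 < z ^ (-α) := Real.rpow_pos_of_pos hz _
    have h4 : z ^ (-α) * z ^ 2 ≤ Real.pi ^ 2 := by
      by_cases h5 : z ≤ 1
      · have h6 : z ^ (-α) * z ≤ 1 := by
          rw [Real.rpow_neg hz.le, inv_mul_le_iff₀ (Real.rpow_pos_of_pos hz _), mul_one]
          simpa using Real.rpow_le_rpow_of_exponent_ge hz h5 hα.2.le
        nlinarith
      · have h6 : z ^ (-α) ≤ 1 :=
          Real.rpow_le_one_of_one_le_of_nonpos (by linarith) (by linarith [hα.1])
        nlinarith
    have h7 : z ^ (-α) * (1 - α - z ^ 2 / 2) ≤ _ := mul_le_mul_of_nonneg_left h2 h3.le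
    nlinarith [mul_pos h3 (sub_pos.2 hα.2)]
  have h2 := monotoneOn_of_odd (g := fun z => coupling α z - -(Real.pi ^ 2 / 2) * z)
    (fun z => by simp only [coupling_neg]; ring)
    (fun z hz hz' => by have := coupling_nonneg (α := α) hz hz'; nlinarith [sq_nonneg Real.pi]) h1
  have := h2 ⟨hb, by linarith⟩ ⟨by linarith, ha⟩ hba
  simp only at this
  linarith

/-- When a - b ≥ π the boundedness of h is enough. Otherwise a translation by a period puts b in
(-π, π], and the estimate on one period applies. -/
theorem coupling_sub_ge {α : ℝ} (hα : 0 ≤ α ∧ α < 1) {a b : ℝ} (hba : b ≤ a) :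
    -(Real.pi ^ 2 / 2) * (a - b) ≤ coupling α a - coupling α b := by
  have hpi := Real.pi_gt_three
  by_cases hab : Real.pi ≤ a - b
  · have h1 := abs_le.1 (abs_coupling_le hα a)
    have h2 := abs_le.1 (abs_coupling_le hα b)
    nlinarith
  push Not at hab
  wlog hb : b ∈ Set.Ioc (-Real.pi) (-Real.pi + 2 * Real.pi) generalizing a b
  · set n := toIocDiv Real.two_pi_pos (-Real.pi) b
    have h3 := this (a := a - n • (2 * Real.pi)) (b := b - n • (2 * Real.pi))
      (by linarith) (by linarith) (sub_toIocDiv_zsmul_mem_Ioc Real.two_pi_pos _ b)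
    rw [(coupling_periodic α).sub_zsmul_eq, (coupling_periodic α).sub_zsmul_eq] at h3
    linarith
  have hb1 := hb.1
  have hb2 := hb.2
  by_cases ha : a ≤ Real.pi
  · exact coupling_sub_ge_near hα hba hb1.le ha
  -- Here a has passed the seam π. Since h vanishes there, the estimates on [b, π] and on [π, a]
  -- (shifted back by 2π) add up.
  · have h3 := coupling_sub_ge_near hα (a := a - 2 * Real.pi) (b := -Real.pi)
      (by linarith) le_rfl (by linarith)
    have h4 := coupling_sub_ge_near hα (a := Real.pi) (b := b) (by linarith) hb1.le le_rfl
    rw [(coupling_periodic α).sub_eq, coupling_neg] at h3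
    rw [coupling_pi] at h3 h4
    linarith

/-- The coupling function is one-sided Lipschitz. -/
theorem coupling_oneSidedLipschitz {α : ℝ} (hα : 0 ≤ α ∧ α < 1) (a b : ℝ) :
    -(Real.pi ^ 2 / 2) * (a - b) ^ 2 ≤ (coupling α a - coupling α b) * (a - b) := by
  rcases le_total b a with h | h
  · nlinarith [coupling_sub_ge hα h]
  · nlinarith [coupling_sub_ge hα h]

/-- The coupling function is strongly monotone near `0`. -/
theorem coupling_strongMono {α d : ℝ} (hα : 0 ≤ α ∧ α < 1) (hd : d ^ 2 ≤ 1 - α) (hd0 : 0 ≤ d)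
    {a b : ℝ} (ha : |a| ≤ d) (hb : |b| ≤ d) :
    (1 - α) / 2 * (a - b) ^ 2 ≤ (coupling α a - coupling α b) * (a - b) := by
  have hpi := Real.pi_gt_three
  -- With z ≤ d ≤ 1 the factor z^(-α) is at least 1, and z² ≤ 1 - α leaves half of 1 - α in the
  -- bracket.
  have hd1 : d ≤ 1 := by nlinarith [hα.1]
  have h1 : MonotoneOn (fun z => coupling α z - (1 - α) / 2 * z) (Set.Ioc 0 d) := by
    refine monotoneOn_coupling_sub (by linarith) fun z hz hz' => ?_
    have h2 := le_deriv_bracket hα.1 hz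
    have h3 : 1 ≤ z ^ (-α) :=
      Real.one_le_rpow_of_pos_of_le_one_of_nonpos hz (by linarith) (by linarith [hα.1])
    have h4 : (1 - α) / 2 ≤ Real.cos z - α * (Real.sin z / z) := by nlinarith
    nlinarith [hα.2]
  have h2 := monotoneOn_of_odd (g := fun z => coupling α z - (1 - α) / 2 * z)
    (fun z => by simp only [coupling_neg]; ring)
    (fun z hz hz' => by
      rcases hz.eq_or_lt with rfl | hz
      · simp [coupling_zero]
      rw [coupling_of_mem hz (by linarith)]
      have h3 : 1 ≤ z ^ (-α) :=
        Real.one_le_rpow_of_pos_of_le_one_of_nonpos hz (by linarith) (by linarith [hα.1])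
      have h4 := Real.sin_gt_sub_cube hz
      have h5 : z / 2 ≤ Real.sin z := by nlinarith [mul_pos hz hz]
      nlinarith [hα.1]) h1
  rw [abs_le] at ha hb
  rcases le_total b a with h | h
  · have := h2 hb ha h
    simp only at this
    nlinarith
  · have := h2 ha hb h
    simp only at this
    nlinarith

/-! ### Sign condition for phases in a range shorter than π -/

/-- The lower bound `h(z) / z ≥ c` on `|z| ≤ d < π`. -/
def alignRate (d : ℝ) : ℝ := Real.sin d / (d * Real.pi)

theorem alignRate_pos {d : ℝ} (hd : 0 < d) (hd' : d < Real.pi) : 0 < alignRate d :=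
  div_pos (Real.sin_pos_of_pos_of_lt_pi hd hd') (mul_pos hd Real.pi_pos)

/-- Concavity puts the sine above its chord on [0, d], and z^(-α) ≥ 1/π because z^α ≤ π. -/
theorem alignRate_mul_le {α d z : ℝ} (hα : 0 ≤ α ∧ α < 1) (hd' : d < Real.pi) (hz : 0 < z)
    (hzd : z ≤ d) : alignRate d * z ≤ coupling α z := by
  have hpi := Real.pi_gt_three
  have hd : 0 < d := hz.trans_le hzd
  have h1 : z / d * Real.sin d ≤ Real.sin z := by
    have hzd' : 0 ≤ 1 - z / d := by rw [sub_nonneg, div_le_one hd]; exact hzd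
    have h0 : (0 : ℝ) ∈ Set.Icc 0 Real.pi := ⟨le_rfl, Real.pi_pos.le⟩
    have := strictConcaveOn_sin_Icc.concaveOn.2 h0 (show d ∈ Set.Icc 0 Real.pi from ⟨hd.le, hd'.le⟩)
      hzd' (show 0 ≤ z / d by positivity) (by ring)
    simpa [div_mul_cancel₀ _ hd.ne'] using this
  have h2 : Real.pi⁻¹ ≤ z ^ (-α) := by
    rw [Real.rpow_neg hz.le]
    gcongr
    calc z ^ α ≤ Real.pi ^ α := Real.rpow_le_rpow hz.le (by linarith) hα.1
      _ ≤ Real.pi ^ (1 : ℝ) := Real.rpow_le_rpow_of_exponent_le (by linarith) hα.2.le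
      _ = Real.pi := Real.rpow_one _
  rw [coupling_of_mem hz (by linarith)]
  calc alignRate d * z = (z / d * Real.sin d) * Real.pi⁻¹ := by
        rw [alignRate]; field_simp
    _ ≤ Real.sin z * z ^ (-α) := by
      have := Real.sin_nonneg_of_nonneg_of_le_pi hz.le (by linarith)
      gcongr

theorem alignRate_mul_mul_le {α d a b : ℝ} (hα : 0 ≤ α ∧ α < 1) (hd' : d < Real.pi)
    (hab : 0 ≤ a * b) (ha : |a| ≤ d) : alignRate d * (a * b) ≤ coupling α a * b := by
  rcases lt_trichotomy a 0 with h | h | h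
  · have hb : b ≤ 0 := by by_contra hb; push Not at hb; nlinarith
    have := alignRate_mul_le hα hd' (z := -a) (by linarith) (by rwa [abs_of_neg h] at ha)
    rw [coupling_neg] at this
    nlinarith
  · simp [h, coupling_zero]
  · have hb : 0 ≤ b := by by_contra hb; push Not at hb; nlinarith
    have := alignRate_mul_le hα hd' (z := a) (by linarith) (by rwa [abs_of_pos h] at ha)
    nlinarith

/-- The sign condition `h(a) b ≥ c a b`, up to a quadratic error, when `a` exceeds the range
`|a| ≤ D` by at most `s`. -/
theorem exists_coupling_mul_ge {D d : ℝ} (hD : 0 < D) (hDd : D < d) (hd' : d < Real.pi) :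
    ∃ C, 0 ≤ C ∧ ∀ α, 0 ≤ α ∧ α < 1 → ∀ a b s : ℝ, 0 ≤ a * b → |b| ≤ s → |a| ≤ D + s →
      alignRate d * (a * b) - C * s ^ 2 ≤ coupling α a * b := by
  have hpi := Real.pi_gt_three
  have hr := alignRate_pos (hD.trans hDd) hd'
  have hg : 0 < d - D := by linarith
  -- If |a| > d, then s > d - D, so every term linear in s is at most its coefficient times s²/(d -
  -- D). The first summand absorbs these; the second absorbs the s² part of `alignRate d` * (D + s)
  -- * s.
  refine ⟨(Real.pi + alignRate d * D) / (d - D) + alignRate d, by positivity, ?_⟩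
  intro α hα a b s hab hb ha
  have hs : 0 ≤ s := (abs_nonneg b).trans hb
  set K := (Real.pi + alignRate d * D) / (d - D) with hK
  have hK0 : 0 ≤ K := by positivity
  by_cases had : |a| ≤ d
  · have := alignRate_mul_mul_le hα hd' hab had
    have : 0 ≤ (K + alignRate d) * s ^ 2 := by positivity
    linarith
  · push Not at had
    have h1 : d - D ≤ s := by linarith
    have h2 : (Real.pi + alignRate d * D) * s ≤ K * s ^ 2 := by
      have : Real.pi + alignRate d * D = K * (d - D) := by rw [hK]; field_simp
      rw [this]
      nlinarith [mul_nonneg hK0 hs]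
    have h3 : a * b ≤ (D + s) * s := by
      calc a * b ≤ |a * b| := le_abs_self _
        _ = |a| * |b| := abs_mul _ _
        _ ≤ (D + s) * s := by gcongr
    have h4 : -(Real.pi * s) ≤ coupling α a * b := by
      have : |coupling α a * b| ≤ Real.pi * s := by
        rw [abs_mul]
        have := abs_coupling_le hα a
        gcongr
      linarith [(abs_le.1 this).1]
    nlinarith [mul_le_mul_of_nonneg_left h3 hr.le]

/-- Dissipation estimate for the difference of two couplings with different weights. -/
theorem weighted_coupling_diff_ge {α V W : ℝ} (hα : 0 ≤ α ∧ α < 1) (hV : 0 ≤ V) (hW : 0 ≤ W)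
    (a b : ℝ) : -(Real.pi ^ 2 / 2) * ((V + W) * (a - b) ^ 2) - Real.pi * |V - W| ≤
      (V * coupling α a - W * coupling α b) * (a - b) := by
  have hpi := Real.pi_gt_three
  have ha := abs_coupling_le hα a
  have hb := abs_coupling_le hα b
  by_cases h : |a - b| ≤ 1
  · have h1 := mul_le_mul_of_nonneg_left (coupling_oneSidedLipschitz hα a b) hW
    have h2 : |(V - W) * coupling α a * (a - b)| ≤ Real.pi * |V - W| := by
      rw [abs_mul, abs_mul]
      calc |V - W| * |coupling α a| * |a - b| ≤ |V - W| * Real.pi * 1 := by gcongr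
        _ = _ := by ring
    have h3 := (abs_le.1 h2).1
    have h4 : 0 ≤ Real.pi ^ 2 / 2 * (V * (a - b) ^ 2) := by positivity
    nlinarith
  -- Now |a - b| ≤ (a - b)², so the crude bound of h already fits into the quadratic term.
  · push Not at h
    have h1 : |(V * coupling α a - W * coupling α b) * (a - b)| ≤
        Real.pi * ((V + W) * (a - b) ^ 2) := by
      rw [abs_mul]
      have : |V * coupling α a - W * coupling α b| ≤ (V + W) * Real.pi := by
        calc _ ≤ |V * coupling α a| + |W * coupling α b| := abs_sub _ _
          _ = V * |coupling α a| + W * |coupling α b| := by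
            rw [abs_mul, abs_mul, abs_of_nonneg hV, abs_of_nonneg hW]
          _ ≤ V * Real.pi + W * Real.pi := by gcongr
          _ = _ := by ring
      calc _ ≤ (V + W) * Real.pi * |a - b| := by gcongr
        _ ≤ (V + W) * Real.pi * |a - b| ^ 2 := by
          gcongr
          nlinarith
        _ = _ := by rw [sq_abs]; ring
    have h2 := (abs_le.1 h1).1
    have h3 : 0 ≤ (V + W) * (a - b) ^ 2 := by positivity
    have h4 : 0 ≤ Real.pi * |V - W| := by positivity
    have h5 : Real.pi ≤ Real.pi ^ 2 / 2 := by nlinarith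
    linarith [mul_le_mul_of_nonneg_right h5 h3]

theorem weighted_coupling_diff_ge_of_small {α d V W : ℝ} (hα : 0 ≤ α ∧ α < 1)
    (hd : d ^ 2 ≤ 1 - α) (hd0 : 0 ≤ d) (hW : 1 ≤ W) {a b : ℝ} (ha : |a| ≤ d) (hb : |b| ≤ d) :
    (1 - α) / 2 * (a - b) ^ 2 - 2 * Real.pi * |V - W| ≤
      (V * coupling α a - W * coupling α b) * (a - b) := by
  have hd1 : d ≤ 1 := by nlinarith [hα.1]
  have h1 := coupling_strongMono hα hd hd0 ha hb
  have h0 : 0 ≤ (1 - α) / 2 * (a - b) ^ 2 := by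
    have := hα.2
    have : 0 ≤ (1 - α) / 2 := by linarith
    positivity
  have h2 : |(V - W) * coupling α a * (a - b)| ≤ 2 * Real.pi * |V - W| := by
    rw [abs_mul, abs_mul]
    have h3 : |a - b| ≤ 2 := (abs_sub _ _).trans (by linarith)
    calc |V - W| * |coupling α a| * |a - b| ≤ |V - W| * Real.pi * 2 := by
          gcongr
          exact abs_coupling_le hα a
      _ = _ := by ring
  have h3 := (abs_le.1 h2).1
  nlinarith

/-! ### Integration against symmetric kernels with bounded rows -/

instance isProbabilityMeasure_unitMeasure : IsProbabilityMeasure unitMeasure :=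
  ⟨by simp [unitMeasure]⟩

/-- Lebesgue measure on `Ω²`. -/
abbrev squareMeasure : Measure (ℝ × ℝ) := unitMeasure.prod unitMeasure

/-- Symmetric kernels on `Ω²` with values in `[1, ∞)` and row integrals at most `K`. -/
structure IsAdmissible (K : ℝ) (W : ℝ → ℝ → ℝ) : Prop where
  measurable : Measurable (Function.uncurry W)
  symm : ∀ x y, W x y = W y x
  nonneg : ∀ x y, 0 ≤ W x y
  one_le : ∀ᵐ p ∂squareMeasure, 1 ≤ W p.1 p.2
  integrable_row : ∀ᵐ x ∂unitMeasure, Integrable (W x) unitMeasure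
  row_le : ∀ᵐ x ∂unitMeasure, ∫ y, W x y ∂unitMeasure ≤ K

/-- Swapping the variables turns f(x) into -f(y); the average of the two expressions is the
right-hand side. -/
theorem integral_prod_antisymm {G : ℝ × ℝ → ℝ} {f : ℝ → ℝ} (hG : ∀ p, G p.swap = -G p)
    (hi : Integrable (fun p => G p * f p.1) squareMeasure) :
    ∫ p, G p * f p.1 ∂squareMeasure =
      -(1 / 2) * ∫ p, G p * (f p.2 - f p.1) ∂squareMeasure := by
  have h1 : (fun p : ℝ × ℝ => G p * f p.2) = fun p => -((fun p => G p * f p.1) p.swap) := by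
    funext p
    simp [hG]
  have hi2 : Integrable (fun p => G p * f p.2) squareMeasure := by
    rw [h1]
    exact hi.swap.neg
  have h2 : ∫ p, G p * f p.2 ∂squareMeasure = -∫ p, G p * f p.1 ∂squareMeasure := by
    rw [h1, integral_neg, integral_prod_swap (fun p : ℝ × ℝ => G p * f p.1)]
  simp_rw [mul_sub]
  rw [integral_sub hi2 hi, h2]
  ring

namespace IsAdmissible

variable {K : ℝ} {W : ℝ → ℝ → ℝ}

theorem measurable_pair (hW : IsAdmissible K W) : Measurable fun p : ℝ × ℝ => W p.1 p.2 :=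
  hW.measurable

/-- Integrating in y first, only the row integrals of W enter. Hence W need not be square
integrable, which matters for β ≥ 1/2. -/
theorem integrable_mul_fst (hW : IsAdmissible K W) {g : ℝ → ℝ} (hg : Integrable g unitMeasure) :
    Integrable (fun p : ℝ × ℝ => W p.1 p.2 * g p.1) squareMeasure := by
  have hm : AEStronglyMeasurable (fun p : ℝ × ℝ => W p.1 p.2 * g p.1) squareMeasure :=
    hW.measurable_pair.aestronglyMeasurable.mul hg.1.comp_fst
  rw [integrable_prod_iff hm]
  refine ⟨?_, ?_⟩
  · filter_upwards [hW.integrable_row] with x hx using hx.mul_const _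
  · refine Integrable.mono' (hg.norm.const_mul K) hm.norm.integral_prod_right' ?_
    filter_upwards [hW.row_le] with x hx
    have h1 : ∫ y, ‖W x y * g x‖ ∂unitMeasure = (∫ y, W x y ∂unitMeasure) * ‖g x‖ := by
      rw [← integral_mul_const]
      refine integral_congr_ae (Eventually.of_forall fun y => ?_)
      simp [abs_of_nonneg (hW.nonneg x y)]
    have h2 : 0 ≤ ∫ y, W x y ∂unitMeasure := integral_nonneg fun y => hW.nonneg x y
    rw [h1, Real.norm_of_nonneg (by positivity)]
    gcongr

theorem integral_mul_fst_le (hW : IsAdmissible K W) {g : ℝ → ℝ} (hg : Integrable g unitMeasure)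
    (h0 : ∀ x, 0 ≤ g x) :
    ∫ p : ℝ × ℝ, W p.1 p.2 * g p.1 ∂squareMeasure ≤ K * ∫ x, g x ∂unitMeasure := by
  have hi := hW.integrable_mul_fst hg
  rw [integral_prod _ hi, ← integral_const_mul]
  refine integral_mono_ae hi.integral_prod_left (hg.const_mul K) ?_
  filter_upwards [hW.row_le] with x hx
  rw [integral_mul_const]
  exact mul_le_mul_of_nonneg_right hx (h0 x)

theorem integrable_mul_snd (hW : IsAdmissible K W) {g : ℝ → ℝ} (hg : Integrable g unitMeasure) :
    Integrable (fun p : ℝ × ℝ => W p.1 p.2 * g p.2) squareMeasure := by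
  have := (hW.integrable_mul_fst hg).swap
  refine this.congr (Eventually.of_forall fun p => ?_)
  simp [hW.symm p.2 p.1]

theorem integral_mul_snd (hW : IsAdmissible K W) (g : ℝ → ℝ) :
    ∫ p : ℝ × ℝ, W p.1 p.2 * g p.2 ∂squareMeasure =
      ∫ p : ℝ × ℝ, W p.1 p.2 * g p.1 ∂squareMeasure := by
  rw [← integral_prod_swap (fun p : ℝ × ℝ => W p.1 p.2 * g p.1)]
  refine integral_congr_ae (Eventually.of_forall fun p => ?_)
  simp [hW.symm p.2 p.1]

theorem integrable (hW : IsAdmissible K W) :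
    Integrable (fun p : ℝ × ℝ => W p.1 p.2) squareMeasure := by
  simpa using hW.integrable_mul_fst (g := fun _ => 1) (integrable_const 1)

/-- Functions dominated by `W(x, y) (f(x)² + f(y)²)`. -/
theorem integrable_mul_sq_add_sq (hW : IsAdmissible K W) {f : ℝ → ℝ} (hf : MemLp f 2 unitMeasure) :
    Integrable (fun p : ℝ × ℝ => W p.1 p.2 * (f p.1 ^ 2 + f p.2 ^ 2)) squareMeasure := by
  have := (hW.integrable_mul_fst hf.integrable_sq).add (hW.integrable_mul_snd hf.integrable_sq)
  refine this.congr (Eventually.of_forall fun p => ?_)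
  simp [mul_add]

theorem integral_mul_sq_add_sq_le (hW : IsAdmissible K W) {f : ℝ → ℝ}
    (hf : MemLp f 2 unitMeasure) :
    ∫ p : ℝ × ℝ, W p.1 p.2 * (f p.1 ^ 2 + f p.2 ^ 2) ∂squareMeasure ≤
      2 * K * ∫ x, f x ^ 2 ∂unitMeasure := by
  simp_rw [mul_add]
  rw [integral_add (hW.integrable_mul_fst hf.integrable_sq)
    (hW.integrable_mul_snd hf.integrable_sq), hW.integral_mul_snd (fun x => f x ^ 2)]
  linarith [hW.integral_mul_fst_le hf.integrable_sq fun x => sq_nonneg (f x)]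

theorem integrable_of_le (hW : IsAdmissible K W) {f : ℝ → ℝ} (hf : MemLp f 2 unitMeasure)
    {F : ℝ × ℝ → ℝ} (hF : AEStronglyMeasurable F squareMeasure) (C : ℝ)
    (h : ∀ p, |F p| ≤ C * (W p.1 p.2 * (1 + (f p.1 ^ 2 + f p.2 ^ 2)))) :
    Integrable F squareMeasure := by
  have h1 := (hW.integrable.add (hW.integrable_mul_sq_add_sq hf)).const_mul C
  refine h1.mono' hF (Eventually.of_forall fun p => ?_)
  have := h p
  simp only [Pi.add_apply, Real.norm_eq_abs]
  linarith

end IsAdmissible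

theorem aestronglyMeasurable_diff {u : ℝ → ℝ}
    (hu : AEStronglyMeasurable u unitMeasure) :
    AEStronglyMeasurable (fun p : ℝ × ℝ => u p.2 - u p.1) squareMeasure :=
  hu.comp_snd.sub hu.comp_fst

theorem aestronglyMeasurable_coupling_diff (α : ℝ) {u : ℝ → ℝ}
    (hu : AEStronglyMeasurable u unitMeasure) :
    AEStronglyMeasurable (fun p : ℝ × ℝ => coupling α (u p.2 - u p.1)) squareMeasure :=
  ((measurable_coupling α).comp_aemeasurable (aestronglyMeasurable_diff hu).aemeasurable).aestronglyMeasurable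

theorem IsAdmissible.integrable_coupling_mul {K α : ℝ} {W : ℝ → ℝ → ℝ} (hα : 0 ≤ α ∧ α < 1)
    (hW : IsAdmissible K W) {u f : ℝ → ℝ} (hu : AEStronglyMeasurable u unitMeasure)
    (hf : MemLp f 2 unitMeasure) :
    Integrable (fun p : ℝ × ℝ => W p.1 p.2 * coupling α (u p.2 - u p.1) * f p.1)
      squareMeasure := by
  refine hW.integrable_of_le hf ?_ Real.pi fun p => ?_
  · exact (hW.measurable_pair.aestronglyMeasurable.mul
      (aestronglyMeasurable_coupling_diff α hu)).mul hf.1.comp_fst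
  · rw [abs_mul, abs_mul, abs_of_nonneg (hW.nonneg _ _)]
    have h1 := abs_coupling_le hα (u p.2 - u p.1)
    have h2 : |f p.1| ≤ 1 + (f p.1 ^ 2 + f p.2 ^ 2) := by
      rw [abs_le]; constructor <;> nlinarith [sq_nonneg (f p.1 - 1), sq_nonneg (f p.1 + 1), sq_nonneg (f p.2)]
    have h3 := hW.nonneg p.1 p.2
    calc W p.1 p.2 * |coupling α (u p.2 - u p.1)| * |f p.1|
        ≤ W p.1 p.2 * Real.pi * (1 + (f p.1 ^ 2 + f p.2 ^ 2)) := by gcongr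
      _ = _ := by ring

/-! ### Testing the equation -/

/-- Testing the right-hand side of the equation with `f`. -/
theorem integral_mul_velocity {K α κ ν : ℝ} {W : ℝ → ℝ → ℝ} (hα : 0 ≤ α ∧ α < 1)
    (hW : IsAdmissible K W) {u f v : ℝ → ℝ} (hu : AEStronglyMeasurable u unitMeasure)
    (hf : MemLp f 2 unitMeasure) (hv : v =ᵐ[unitMeasure] velocity α κ W (fun _ => ν) u) :
    ∫ x, f x * v x ∂unitMeasure = ν * ∫ x, f x ∂unitMeasure +
      κ * ∫ p : ℝ × ℝ, W p.1 p.2 * coupling α (u p.2 - u p.1) * f p.1 ∂squareMeasure := by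
  have hi := hW.integrable_coupling_mul hα hu hf
  have hfi : Integrable f unitMeasure := hf.integrable one_le_two
  rw [integral_prod _ hi, ← integral_const_mul, ← integral_const_mul,
    ← integral_add (hfi.const_mul ν) (hi.integral_prod_left.const_mul κ)]
  refine integral_congr_ae ?_
  filter_upwards [hv] with x hx
  simp only [hx, velocity]
  rw [integral_mul_const]
  ring

theorem coupling_kernel_antisymm {K α : ℝ} {W : ℝ → ℝ → ℝ} (hW : IsAdmissible K W) (u : ℝ → ℝ)
    (p : ℝ × ℝ) : W p.swap.1 p.swap.2 * coupling α (u p.swap.2 - u p.swap.1) =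
      -(W p.1 p.2 * coupling α (u p.2 - u p.1)) := by
  rw [Prod.fst_swap, Prod.snd_swap, hW.symm p.2 p.1, ← neg_sub, coupling_neg]
  ring

/-- The coupling term is antisymmetric, so its double integral vanishes and the mean phase moves
with speed ν. -/
theorem integral_velocity {K α κ ν : ℝ} {W : ℝ → ℝ → ℝ} (hα : 0 ≤ α ∧ α < 1)
    (hW : IsAdmissible K W) {u v : ℝ → ℝ} (hu : AEStronglyMeasurable u unitMeasure)
    (hv : v =ᵐ[unitMeasure] velocity α κ W (fun _ => ν) u) :
    ∫ x, v x ∂unitMeasure = ν := by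
  have h1 := integral_mul_velocity hα hW hu (memLp_const (1 : ℝ)) hv
  have h2 := integral_prod_antisymm (f := fun _ => (1 : ℝ)) (coupling_kernel_antisymm (α := α) hW u)
    (hW.integrable_coupling_mul hα hu (memLp_const (1 : ℝ)))
  rw [h2] at h1
  simpa using h1

/-- Tested difference of the velocities of two solutions with different kernels. -/
theorem integral_mul_velocity_sub {K α κ ν : ℝ} {V W : ℝ → ℝ → ℝ} (hα : 0 ≤ α ∧ α < 1)
    (hV : IsAdmissible K V) (hW : IsAdmissible K W) {u u' v v' f : ℝ → ℝ}
    (hu : AEStronglyMeasurable u unitMeasure) (hu' : AEStronglyMeasurable u' unitMeasure)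
    (hf : MemLp f 2 unitMeasure) (hfv : Integrable (fun x => f x * v x) unitMeasure)
    (hfv' : Integrable (fun x => f x * v' x) unitMeasure)
    (hv : v =ᵐ[unitMeasure] velocity α κ V (fun _ => ν) u)
    (hv' : v' =ᵐ[unitMeasure] velocity α κ W (fun _ => ν) u') :
    ∫ x, f x * (v x - v' x) ∂unitMeasure = -(κ / 2) *
      ∫ p : ℝ × ℝ, (V p.1 p.2 * coupling α (u p.2 - u p.1)
        - W p.1 p.2 * coupling α (u' p.2 - u' p.1)) * (f p.2 - f p.1) ∂squareMeasure := by
  have hi := hV.integrable_coupling_mul hα hu hf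
  have hi' := hW.integrable_coupling_mul hα hu' hf
  have h1 := integral_mul_velocity hα hV hu hf hv
  have h2 := integral_mul_velocity hα hW hu' hf hv'
  have h3 := integral_prod_antisymm (f := f) (G := fun p : ℝ × ℝ =>
      V p.1 p.2 * coupling α (u p.2 - u p.1) - W p.1 p.2 * coupling α (u' p.2 - u' p.1))
    (fun p => by
      simp only [coupling_kernel_antisymm hV, coupling_kernel_antisymm hW]; ring)
    ((hi.sub hi').congr (Eventually.of_forall fun p => by simp [sub_mul]))
  have h4 : ∫ p : ℝ × ℝ, (V p.1 p.2 * coupling α (u p.2 - u p.1)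
        - W p.1 p.2 * coupling α (u' p.2 - u' p.1)) * f p.1 ∂squareMeasure =
      ∫ p : ℝ × ℝ, V p.1 p.2 * coupling α (u p.2 - u p.1) * f p.1 ∂squareMeasure
        - ∫ p : ℝ × ℝ, W p.1 p.2 * coupling α (u' p.2 - u' p.1) * f p.1 ∂squareMeasure := by
    rw [← integral_sub hi hi']
    simp_rw [sub_mul]
  rw [h4] at h3
  simp_rw [mul_sub (f _)]
  rw [integral_sub hfv hfv', h1, h2]
  linear_combination κ * h3

theorem IsAdmissible.integrable_coupling_mul_diff {K α : ℝ} {W : ℝ → ℝ → ℝ}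
    (hα : 0 ≤ α ∧ α < 1) (hW : IsAdmissible K W) {u f : ℝ → ℝ}
    (hu : AEStronglyMeasurable u unitMeasure) (hf : MemLp f 2 unitMeasure) :
    Integrable (fun p : ℝ × ℝ => W p.1 p.2 * coupling α (u p.2 - u p.1) * (f p.2 - f p.1))
      squareMeasure := by
  have h1 := hW.integrable_coupling_mul hα hu hf
  refine (h1.add h1.swap).neg.congr (Eventually.of_forall fun p => ?_)
  have := coupling_kernel_antisymm (α := α) hW u p
  simp only [Pi.neg_apply, Pi.add_apply, Function.comp_apply, this]
  simp only [Prod.fst_swap]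
  ring

theorem integral_sq_diff {f : ℝ → ℝ} (hf : MemLp f 2 unitMeasure) :
    ∫ p : ℝ × ℝ, (f p.1 - f p.2) ^ 2 ∂squareMeasure =
      2 * ∫ x, f x ^ 2 ∂unitMeasure - 2 * (∫ x, f x ∂unitMeasure) ^ 2 := by
  have hfi : Integrable f unitMeasure := hf.integrable one_le_two
  have h1 := hf.integrable_sq.comp_fst unitMeasure
  have h2 := hf.integrable_sq.comp_snd unitMeasure
  have h3 := hfi.mul_prod hfi
  have h4 : ∀ p : ℝ × ℝ, (f p.1 - f p.2) ^ 2 = f p.1 ^ 2 + f p.2 ^ 2 - 2 * (f p.1 * f p.2) :=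
    fun p => by ring
  simp_rw [h4]
  rw [integral_sub (h1.fun_add h2) (h3.const_mul 2), integral_add h1 h2, integral_const_mul,
    integral_prod_mul f f, integral_fun_fst (fun x => f x ^ 2), integral_fun_snd (fun x => f x ^ 2)]
  simp
  ring

theorem integrable_sq_diff {f : ℝ → ℝ} (hf : MemLp f 2 unitMeasure) :
    Integrable (fun p : ℝ × ℝ => (f p.1 - f p.2) ^ 2) squareMeasure := by
  have hfi : Integrable f unitMeasure := hf.integrable one_le_two
  have h := ((hf.integrable_sq.comp_fst unitMeasure).add
    (hf.integrable_sq.comp_snd unitMeasure)).sub ((hfi.mul_prod hfi).const_mul 2)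
  refine h.congr (Eventually.of_forall fun p => ?_)
  simp
  ring

theorem integrable_abs_kernel_sub {V W : ℝ → ℝ → ℝ}
    (hV : Integrable (fun p : ℝ × ℝ => V p.1 p.2) squareMeasure)
    (hW : Integrable (fun p : ℝ × ℝ => W p.1 p.2) squareMeasure) :
    Integrable (fun p : ℝ × ℝ => |V p.1 p.2 - W p.1 p.2|) squareMeasure :=
  (hV.sub hW).abs

theorem kernelDist_nonneg (V W : ℝ → ℝ → ℝ) : 0 ≤ kernelDist V W :=
  integral_nonneg fun _ => abs_nonneg _

/-- Growth estimate for the difference of two solutions: `f = u - u'` tested with the difference of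
the velocities. -/
theorem integral_mul_velocity_sub_le {K α κ ν : ℝ} {V W : ℝ → ℝ → ℝ} (hα : 0 ≤ α ∧ α < 1)
    (hκ : 0 < κ) (hV : IsAdmissible K V) (hW : IsAdmissible K W) {u u' v v' : ℝ → ℝ}
    (hu : MemLp u 2 unitMeasure) (hu' : MemLp u' 2 unitMeasure)
    (hvi : MemLp v 2 unitMeasure) (hvi' : MemLp v' 2 unitMeasure)
    (hv : v =ᵐ[unitMeasure] velocity α κ V (fun _ => ν) u)
    (hv' : v' =ᵐ[unitMeasure] velocity α κ W (fun _ => ν) u') :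
    ∫ x, (u x - u' x) * (v x - v' x) ∂unitMeasure ≤
      2 * κ * Real.pi ^ 2 * K * (∫ x, (u x - u' x) ^ 2 ∂unitMeasure)
        + κ / 2 * Real.pi * kernelDist V W := by
  have hf : MemLp (fun x => u x - u' x) 2 unitMeasure := hu.sub hu'
  rw [integral_mul_velocity_sub hα hV hW hu.1 hu'.1 hf (hf.integrable_mul hvi)
    (hf.integrable_mul hvi') hv hv']
  have hiV := hV.integrable_mul_sq_add_sq hf
  have hiW := hW.integrable_mul_sq_add_sq hf
  have hlow : Integrable (fun p : ℝ × ℝ => -(Real.pi ^ 2) *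
      (V p.1 p.2 * ((u p.1 - u' p.1) ^ 2 + (u p.2 - u' p.2) ^ 2)
        + W p.1 p.2 * ((u p.1 - u' p.1) ^ 2 + (u p.2 - u' p.2) ^ 2))
      - Real.pi * |V p.1 p.2 - W p.1 p.2|) squareMeasure :=
    ((hiV.add hiW).const_mul _).sub ((integrable_abs_kernel_sub hV.integrable hW.integrable).const_mul _)
  have hint : Integrable (fun p : ℝ × ℝ => (V p.1 p.2 * coupling α (u p.2 - u p.1)
        - W p.1 p.2 * coupling α (u' p.2 - u' p.1)) * (u p.2 - u' p.2 - (u p.1 - u' p.1)))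
      squareMeasure := by
    refine ((hV.integrable_coupling_mul_diff hα hu.1 hf).sub
      (hW.integrable_coupling_mul_diff hα hu'.1 hf)).congr (Eventually.of_forall fun p => ?_)
    simp [sub_mul]
  have hle := integral_mono hlow hint fun p => by
    have h1 := weighted_coupling_diff_ge hα (hV.nonneg p.1 p.2) (hW.nonneg p.1 p.2)
      (u p.2 - u p.1) (u' p.2 - u' p.1)
    -- This separates the variables, so that the row bounds of V and W apply to each square.
    have h2 : (u p.2 - u p.1 - (u' p.2 - u' p.1)) ^ 2 ≤
        2 * ((u p.1 - u' p.1) ^ 2 + (u p.2 - u' p.2) ^ 2) := by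
      nlinarith [sq_nonneg (u p.2 - u p.1 - (u' p.2 - u' p.1)),
        sq_nonneg ((u p.1 - u' p.1) + (u p.2 - u' p.2))]
    have h3 := mul_le_mul_of_nonneg_left h2 (add_nonneg (hV.nonneg p.1 p.2) (hW.nonneg p.1 p.2))
    have h4 := mul_le_mul_of_nonneg_left h3 (by positivity : 0 ≤ Real.pi ^ 2 / 2)
    have h5 : u p.2 - u' p.2 - (u p.1 - u' p.1) = u p.2 - u p.1 - (u' p.2 - u' p.1) := by ring
    simp only [h5]
    linarith
  rw [integral_sub ((hiV.fun_add hiW).const_mul _) ((integrable_abs_kernel_sub hV.integrable hW.integrable).const_mul _),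
    integral_const_mul, integral_const_mul, integral_add hiV hiW] at hle
  have h6 := hV.integral_mul_sq_add_sq_le hf
  have h7 := hW.integral_mul_sq_add_sq_le hf
  have h8 : ∫ p : ℝ × ℝ, |V p.1 p.2 - W p.1 p.2| ∂squareMeasure = kernelDist V W := rfl
  rw [h8] at hle
  have h9 := mul_le_mul_of_nonneg_left (add_le_add h6 h7) (sq_nonneg Real.pi)
  nlinarith

/-- Contraction estimate for the difference of two solutions of small diameter. -/
theorem integral_mul_velocity_sub_le_of_small {K α κ ν d : ℝ} {V W : ℝ → ℝ → ℝ}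
    (hα : 0 ≤ α ∧ α < 1) (hd : d ^ 2 ≤ 1 - α) (hd0 : 0 ≤ d)
    (hκ : 0 < κ) (hV : IsAdmissible K V) (hW : IsAdmissible K W) {u u' v v' : ℝ → ℝ}
    (hu : MemLp u 2 unitMeasure) (hu' : MemLp u' 2 unitMeasure)
    (hvi : MemLp v 2 unitMeasure) (hvi' : MemLp v' 2 unitMeasure)
    (hv : v =ᵐ[unitMeasure] velocity α κ V (fun _ => ν) u)
    (hv' : v' =ᵐ[unitMeasure] velocity α κ W (fun _ => ν) u')
    (hud : ∀ᵐ p ∂squareMeasure, |u p.2 - u p.1| ≤ d)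
    (hud' : ∀ᵐ p ∂squareMeasure, |u' p.2 - u' p.1| ≤ d) :
    ∫ x, (u x - u' x) * (v x - v' x) ∂unitMeasure ≤
      -(κ * (1 - α) / 2) * ((∫ x, (u x - u' x) ^ 2 ∂unitMeasure)
          - (∫ x, (u x - u' x) ∂unitMeasure) ^ 2)
        + κ * Real.pi * kernelDist V W := by
  have hf : MemLp (fun x => u x - u' x) 2 unitMeasure := hu.sub hu'
  rw [integral_mul_velocity_sub hα hV hW hu.1 hu'.1 hf (hf.integrable_mul hvi)
    (hf.integrable_mul hvi') hv hv']
  have hlow : Integrable (fun p : ℝ × ℝ => (1 - α) / 2 *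
      ((u p.1 - u' p.1) - (u p.2 - u' p.2)) ^ 2
      - 2 * Real.pi * |V p.1 p.2 - W p.1 p.2|) squareMeasure :=
    ((integrable_sq_diff hf).const_mul _).sub ((integrable_abs_kernel_sub hV.integrable hW.integrable).const_mul _)
  have hint : Integrable (fun p : ℝ × ℝ => (V p.1 p.2 * coupling α (u p.2 - u p.1)
        - W p.1 p.2 * coupling α (u' p.2 - u' p.1)) * (u p.2 - u' p.2 - (u p.1 - u' p.1)))
      squareMeasure := by
    refine ((hV.integrable_coupling_mul_diff hα hu.1 hf).sub
      (hW.integrable_coupling_mul_diff hα hu'.1 hf)).congr (Eventually.of_forall fun p => ?_)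
    simp [sub_mul]
  -- The bound W ≥ 1 removes the weight from the dissipation, and `integral_sq_diff` turns the
  -- remaining double integral into a variance.
  have hle := integral_mono_ae hlow hint (by
    filter_upwards [hud, hud', hW.one_le] with p h1 h2 h3
    have h4 := weighted_coupling_diff_ge_of_small hα hd hd0 (V := V p.1 p.2) h3 h1 h2
    have h5 : u p.2 - u' p.2 - (u p.1 - u' p.1) = u p.2 - u p.1 - (u' p.2 - u' p.1) := by ring
    have h6 : ((u p.1 - u' p.1) - (u p.2 - u' p.2)) ^ 2 =
      (u p.2 - u p.1 - (u' p.2 - u' p.1)) ^ 2 := by ring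
    simp only [h5, h6]
    linarith)
  rw [integral_sub ((integrable_sq_diff hf).const_mul _)
    ((integrable_abs_kernel_sub hV.integrable hW.integrable).const_mul _), integral_const_mul, integral_const_mul,
    integral_sq_diff hf] at hle
  have h8 : ∫ p : ℝ × ℝ, |V p.1 p.2 - W p.1 p.2| ∂squareMeasure = kernelDist V W := rfl
  rw [h8] at hle
  nlinarith

/-! ### Gronwall's inequality and the distance to an interval -/

/-- The equation holds only at positive times, so derivatives are required in the open interval
alone. The sign of A is free: A > 0 serves the growth estimates, A < 0 the contraction. -/
theorem gronwall_of_interior {f : ℝ → ℝ} {A B s t : ℝ} (hA : A ≠ 0) (hst : s ≤ t)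
    (hc : ContinuousOn f (Set.Icc s t))
    (hd : ∀ τ ∈ Set.Ioo s t, ∃ f', HasDerivAt f f' τ ∧ f' ≤ A * f τ + B) :
    f t + B / A ≤ Real.exp (A * (t - s)) * (f s + B / A) := by
  have hg : AntitoneOn (fun τ => Real.exp (-(A * τ)) * (f τ + B / A)) (Set.Icc s t) := by
    have hderiv : ∀ τ f', HasDerivAt f f' τ →
        HasDerivAt (fun τ => Real.exp (-(A * τ)) * (f τ + B / A))
          (Real.exp (-(A * τ)) * (f' - (A * f τ + B))) τ := by
      intro τ f' h
      have h1 := (((hasDerivAt_id τ).const_mul A).neg.exp).mul (h.add_const (B / A))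
      refine h1.congr_deriv ?_
      simp only [Pi.neg_apply, id]
      field_simp
      ring
    refine antitoneOn_of_deriv_nonpos (convex_Icc s t) ?_ ?_ ?_
    · exact (by fun_prop : Continuous fun τ : ℝ => Real.exp (-(A * τ))).continuousOn.mul
        (hc.add continuousOn_const)
    · intro τ hτ
      rw [interior_Icc] at hτ
      obtain ⟨f', h, -⟩ := hd τ hτ
      exact (hderiv τ f' h).differentiableAt.differentiableWithinAt
    · intro τ hτ
      rw [interior_Icc] at hτ
      obtain ⟨f', h, h'⟩ := hd τ hτ
      rw [(hderiv τ f' h).deriv]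
      exact mul_nonpos_of_nonneg_of_nonpos (Real.exp_pos _).le (by linarith)
  have h := hg ⟨le_rfl, hst⟩ ⟨hst, le_rfl⟩ hst
  simp only at h
  have h1 := mul_le_mul_of_nonneg_left h (Real.exp_pos (A * t)).le
  rw [← mul_assoc, ← mul_assoc, ← Real.exp_add, ← Real.exp_add] at h1
  rw [show A * t + -(A * t) = 0 by ring, show A * t + -(A * s) = A * (t - s) by ring] at h1
  simpa using h1

/-- The signed distance of `r` to the interval `[m, M]`. -/
def excess (m M r : ℝ) : ℝ := r - max m (min r M)

theorem excess_cases {m M : ℝ} (h : m ≤ M) (r : ℝ) :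
    (r < m ∧ excess m M r = r - m) ∨ (m ≤ r ∧ r ≤ M ∧ excess m M r = 0) ∨
      (M < r ∧ excess m M r = r - M) := by
  unfold excess
  rcases lt_or_ge r m with h1 | h1
  · left
    rw [min_eq_left (by linarith), max_eq_left h1.le]
    exact ⟨h1, rfl⟩
  · right
    rcases le_or_gt r M with h2 | h2
    · left
      rw [min_eq_left h2, max_eq_right h1]
      exact ⟨h1, h2, by ring⟩
    · right
      rw [min_eq_right h2.le, max_eq_right h]
      exact ⟨h2, rfl⟩

/-- The squared distance to an interval is convex with derivative 2 * `excess`, which is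
2-Lipschitz. This tangent bound and `excess_sq_upper` make its integral differentiable on L². -/
theorem excess_sq_lower {m M : ℝ} (h : m ≤ M) (u v : ℝ) :
    excess m M u ^ 2 + 2 * excess m M u * (v - u) ≤ excess m M v ^ 2 := by
  rcases excess_cases h u with ⟨hu, eu⟩ | ⟨hu, hu', eu⟩ | ⟨hu, eu⟩ <;>
  rcases excess_cases h v with ⟨hv, ev⟩ | ⟨hv, hv', ev⟩ | ⟨hv, ev⟩ <;>
  rw [eu, ev] <;> nlinarith [sq_nonneg (v - u)]

theorem excess_sq_upper {m M : ℝ} (h : m ≤ M) (u v : ℝ) :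
    excess m M v ^ 2 ≤ excess m M u ^ 2 + 2 * excess m M u * (v - u) + (v - u) ^ 2 := by
  rcases excess_cases h u with ⟨hu, eu⟩ | ⟨hu, hu', eu⟩ | ⟨hu, eu⟩ <;>
  rcases excess_cases h v with ⟨hv, ev⟩ | ⟨hv, hv', ev⟩ | ⟨hv, ev⟩ <;>
  rw [eu, ev] <;> nlinarith

theorem excess_diff_mul_nonneg {m M : ℝ} (h : m ≤ M) (u v : ℝ) :
    0 ≤ (v - u) * (excess m M v - excess m M u) := by
  have h1 := excess_sq_lower h u v
  have h2 := excess_sq_lower h v u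
  nlinarith

theorem abs_sub_le_excess {m M : ℝ} (h : m ≤ M) (u v : ℝ) :
    |v - u| ≤ (M - m) + (|excess m M u| + |excess m M v|) := by
  have hu : ∀ r, r ≤ M + |excess m M r| ∧ m - |excess m M r| ≤ r := by
    intro r
    have h1 := le_abs_self (excess m M r)
    have h2 := neg_abs_le (excess m M r)
    rcases excess_cases h r with ⟨hr, er⟩ | ⟨hr, hr', er⟩ | ⟨hr, er⟩ <;> rw [er] at h1 h2 ⊢ <;>
      constructor <;> linarith [abs_nonneg (0 : ℝ)]
  rw [abs_le]
  constructor <;> linarith [(hu u).1, (hu u).2, (hu v).1, (hu v).2]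

theorem memLp_excess (m M : ℝ) {u : ℝ → ℝ} (hu : MemLp u 2 unitMeasure) :
    MemLp (fun x => excess m M (u x)) 2 unitMeasure := by
  refine hu.sub (MemLp.of_bound (C := |m| + |M|) ?_ ?_)
  · exact (by fun_prop : Continuous fun r : ℝ => max m (min r M)).comp_aestronglyMeasurable hu.1
  · refine Eventually.of_forall fun x => ?_
    rw [Real.norm_eq_abs, abs_le]
    have h1 := neg_abs_le m
    have h2 := le_abs_self m
    have h3 := le_abs_self M
    have h4 := abs_nonneg M
    have h5 := abs_nonneg m
    constructor
    · exact le_trans (by linarith) (le_max_left _ _)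
    · exact max_le (by linarith) ((min_le_right _ _).trans (by linarith))

/-- The squared `L²` distance to the functions with values in `[m, M]`. -/
def excessEnergy (m M : ℝ) (u : L2) : ℝ := ∫ x, excess m M (u x) ^ 2 ∂unitMeasure

theorem excessEnergy_nonneg (m M : ℝ) (u : L2) : 0 ≤ excessEnergy m M u :=
  integral_nonneg fun _ => sq_nonneg _

/-- The pointwise excess as an element of `L²`. -/
def excessL2 (m M : ℝ) (u : L2) : L2 := (memLp_excess m M (Lp.memLp u)).toLp _

theorem coeFn_excessL2 (m M : ℝ) (u : L2) :
    (excessL2 m M u : ℝ → ℝ) =ᵐ[unitMeasure] fun x => excess m M (u x) := MemLp.coeFn_toLp _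

theorem inner_eq_integral (u v : L2) : inner ℝ u v = ∫ x, u x * v x ∂unitMeasure := by
  rw [L2.inner_def]
  simp [mul_comm]

theorem norm_sq_eq_integral (u : L2) : ‖u‖ ^ 2 = ∫ x, u x ^ 2 ∂unitMeasure := by
  rw [← real_inner_self_eq_norm_sq, inner_eq_integral]
  simp_rw [sq]

theorem inner_excessL2 (m M : ℝ) (u v : L2) :
    inner ℝ (excessL2 m M u) v = ∫ x, excess m M (u x) * v x ∂unitMeasure := by
  rw [inner_eq_integral]
  refine integral_congr_ae ?_
  filter_upwards [coeFn_excessL2 m M u] with x hx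
  rw [hx]

/-- Integrating the two pointwise bounds traps the first-order remainder between 0 and the squared
L² norm of the increment, which is Fréchet differentiability. -/
theorem excessEnergy_remainder {m M : ℝ} (h : m ≤ M) (u v : L2) :
    0 ≤ excessEnergy m M v - excessEnergy m M u - 2 * inner ℝ (excessL2 m M u) (v - u) ∧
      excessEnergy m M v - excessEnergy m M u - 2 * inner ℝ (excessL2 m M u) (v - u) ≤
        ‖v - u‖ ^ 2 := by
  have iu := (memLp_excess m M (Lp.memLp u)).integrable_sq
  have iv := (memLp_excess m M (Lp.memLp v)).integrable_sq
  have ip : Integrable (fun x => excess m M (u x) * (v - u : L2) x) unitMeasure :=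
    (memLp_excess m M (Lp.memLp u)).integrable_mul (Lp.memLp (v - u))
  have hs := Lp.coeFn_sub v u
  have key : excessEnergy m M v - excessEnergy m M u - 2 * inner ℝ (excessL2 m M u) (v - u) =
      ∫ x, (excess m M (v x) ^ 2 - excess m M (u x) ^ 2
        - 2 * (excess m M (u x) * (v - u : L2) x)) ∂unitMeasure := by
    have ivu : Integrable (fun x => excess m M (v x) ^ 2 - excess m M (u x) ^ 2) unitMeasure :=
      iv.sub iu
    rw [integral_sub ivu (ip.const_mul 2), integral_sub iv iu, integral_const_mul,
      inner_excessL2]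
    rfl
  rw [key, norm_sq_eq_integral]
  refine ⟨integral_nonneg_of_ae ?_, integral_mono_ae ((iv.sub iu).sub (ip.const_mul 2))
    (Lp.memLp (v - u)).integrable_sq ?_⟩
  · filter_upwards [hs] with x hx
    rw [hx]
    have := excess_sq_lower h (u x) (v x)
    simp only [Pi.zero_apply, Pi.sub_apply]
    linarith
  · filter_upwards [hs] with x hx
    simp only [hx, Pi.sub_apply]
    have := excess_sq_upper h (u x) (v x)
    linarith

theorem hasFDerivAt_excessEnergy {m M : ℝ} (h : m ≤ M) (u : L2) :
    HasFDerivAt (excessEnergy m M) ((2 : ℝ) • innerSL ℝ (excessL2 m M u)) u := by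
  refine HasFDerivAt.of_isLittleO ?_
  refine Asymptotics.IsBigO.trans_isLittleO (g := fun v : L2 => ‖v - u‖ ^ 2) ?_ ?_
  · refine Asymptotics.IsBigO.of_bound 1 (Eventually.of_forall fun v => ?_)
    have := excessEnergy_remainder h u v
    simp only [smul_apply, innerSL_apply_apply, smul_eq_mul]
    rw [Real.norm_of_nonneg this.1, Real.norm_of_nonneg (by positivity), one_mul]
    exact this.2
  · exact Asymptotics.isLittleO_pow_sub_sub u one_lt_two

theorem continuous_excessEnergy {m M : ℝ} (h : m ≤ M) : Continuous (excessEnergy m M) :=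
  continuous_iff_continuousAt.2 fun u => (hasFDerivAt_excessEnergy h u).continuousAt

theorem hasDerivAt_excessEnergy {m M : ℝ} (h : m ≤ M) {η : ℝ → L2} {η' : L2} {t : ℝ}
    (hη : HasDerivAt η η' t) :
    HasDerivAt (fun t => excessEnergy m M (η t)) (2 * inner ℝ (excessL2 m M (η t)) η') t := by
  have := (hasFDerivAt_excessEnergy h (η t)).comp_hasDerivAt t hη
  refine this.congr_deriv ?_
  simp

theorem excessEnergy_eq_zero {m M : ℝ} (h : m ≤ M) {u : L2} :
    excessEnergy m M u = 0 ↔ ∀ᵐ x ∂unitMeasure, m ≤ u x ∧ u x ≤ M := by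
  rw [excessEnergy, integral_eq_zero_iff_of_nonneg (fun _ => sq_nonneg _)
    (memLp_excess m M (Lp.memLp u)).integrable_sq]
  refine eventually_congr (Eventually.of_forall fun x => ?_)
  simp only [Pi.zero_apply, ne_eq, OfNat.ofNat_ne_zero, not_false_eq_true, pow_eq_zero_iff]
  rcases excess_cases h (u x) with ⟨hu, eu⟩ | ⟨hu, hu', eu⟩ | ⟨hu, eu⟩ <;> rw [eu] <;>
    constructor <;> intro h' <;> (try constructor) <;> linarith [h']

/-- A function of essential diameter at most `D` takes its values in an interval of length `D`. -/
theorem exists_bounds_of_diameter {u : ℝ → ℝ} {D : ℝ} (hD : 0 ≤ D)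
    (h : diameter u ≤ ENNReal.ofReal D) :
    ∃ m, ∀ᵐ x ∂unitMeasure, m ≤ u x ∧ u x ≤ m + D := by
  have h1 : ∀ᵐ p ∂squareMeasure, |u p.1 - u p.2| ≤ D := by
    filter_upwards [ENNReal.ae_le_essSup (μ := squareMeasure)
      (fun p : ℝ × ℝ => ‖u p.1 - u p.2‖ₑ)] with p hp
    have h2 := hp.trans h
    rw [Real.enorm_eq_ofReal_abs] at h2
    exact (ENNReal.ofReal_le_ofReal_iff hD).1 h2
  have h2 := Measure.ae_ae_of_ae_prod h1
  obtain ⟨x₀, hx₀⟩ := h2.exists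
  have hb : IsBoundedUnder (· ≤ ·) (ae unitMeasure) u :=
    ⟨u x₀ + D, by
      rw [eventually_map]
      filter_upwards [hx₀] with y hy
      linarith [(abs_le.1 hy).1]⟩
  have hcb : IsCoboundedUnder (· ≤ ·) (ae unitMeasure) u := by
    refine IsBoundedUnder.isCoboundedUnder_le ⟨u x₀ - D, ?_⟩
    rw [eventually_map]
    filter_upwards [hx₀] with y hy
    linarith [(abs_le.1 hy).2]
  -- By Fubini, almost every value u(x) has almost all values of u within D, so the essential
  -- supremum is at most u(x) + D.
  refine ⟨essSup u unitMeasure - D, ?_⟩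
  filter_upwards [h2, ae_le_essSup hb] with x hx hx'
  refine ⟨?_, by linarith⟩
  have : essSup u unitMeasure ≤ u x + D := by
    refine essSup_le_of_ae_le _ ?_ hcb
    filter_upwards [hx] with y hy
    linarith [(abs_le.1 hy).1]
  linarith

/-! ### Exponential decay of the diameter -/

/-- The constant function `1` in `L²`. -/
def oneL2 : L2 := (memLp_const (1 : ℝ)).toLp _

theorem coeFn_oneL2 : (oneL2 : ℝ → ℝ) =ᵐ[unitMeasure] fun _ => 1 := MemLp.coeFn_toLp _

theorem inner_oneL2 (u : L2) : inner ℝ oneL2 u = ∫ x, u x ∂unitMeasure := by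
  rw [inner_eq_integral]
  refine integral_congr_ae ?_
  filter_upwards [coeFn_oneL2] with x hx
  rw [hx, one_mul]

theorem norm_oneL2 : ‖oneL2‖ = 1 := by
  have h : ‖oneL2‖ ^ 2 = 1 := by
    rw [← real_inner_self_eq_norm_sq, inner_oneL2, integral_congr_ae coeFn_oneL2]
    simp
  nlinarith [norm_nonneg oneL2]

/-- The deviation from the mean, magnified by the factor `e^{c t}`. -/
def scaledDeviation (c : ℝ) (θ : ℝ → L2) (t : ℝ) : L2 :=
  Real.exp (c * t) • (θ t - (inner ℝ oneL2 (θ t) : ℝ) • oneL2)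

theorem hasDerivAt_scaledDeviation {c t : ℝ} {θ : ℝ → L2} {v : L2} (h : HasDerivAt θ v t) :
    HasDerivAt (scaledDeviation c θ) (c • scaledDeviation c θ t
      + Real.exp (c * t) • (v - (inner ℝ oneL2 v : ℝ) • oneL2)) t := by
  have h1 : HasDerivAt (fun t => Real.exp (c * t)) (c * Real.exp (c * t)) t := by
    have := ((hasDerivAt_id t).const_mul c).exp
    simpa [mul_comm] using this
  have h2 : HasDerivAt (fun t => (inner ℝ oneL2 (θ t) : ℝ)) (inner ℝ oneL2 v) t :=
    ((innerSL ℝ oneL2).hasFDerivAt.comp_hasDerivAt t h)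
  have h3 := h1.smul (h.sub (h2.smul_const oneL2))
  refine h3.congr_deriv ?_
  simp only [scaledDeviation, smul_smul, Pi.sub_apply]
  rw [add_comm]

theorem continuousOn_scaledDeviation (c : ℝ) {θ : ℝ → L2} {S : Set ℝ} (h : ContinuousOn θ S) :
    ContinuousOn (scaledDeviation c θ) S := by
  have h2 : ContinuousOn (fun t => (inner ℝ oneL2 (θ t) : ℝ)) S :=
    (innerSL ℝ oneL2).continuous.comp_continuousOn h
  exact (by fun_prop : Continuous fun t : ℝ => Real.exp (c * t)).continuousOn.smul
    (h.sub (h2.smul continuousOn_const))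

theorem coeFn_sub_smul_oneL2 (u : L2) (r : ℝ) :
    ((u - r • oneL2 : L2) : ℝ → ℝ) =ᵐ[unitMeasure] fun x => u x - r := by
  filter_upwards [Lp.coeFn_sub u (r • oneL2), Lp.coeFn_smul r oneL2, coeFn_oneL2] with x h1 h2 h3
  rw [h1, Pi.sub_apply, h2, Pi.smul_apply, h3]
  simp

theorem coeFn_scaledDeviation (c : ℝ) (θ : ℝ → L2) (t : ℝ) :
    (scaledDeviation c θ t : ℝ → ℝ) =ᵐ[unitMeasure]
      fun x => Real.exp (c * t) * (θ t x - inner ℝ oneL2 (θ t)) := by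
  filter_upwards [Lp.coeFn_smul (Real.exp (c * t)) (θ t - (inner ℝ oneL2 (θ t) : ℝ) • oneL2),
    coeFn_sub_smul_oneL2 (θ t) (inner ℝ oneL2 (θ t))] with x h1 h2
  rw [scaledDeviation, h1, Pi.smul_apply, h2, smul_eq_mul]

theorem inner_oneL2_scaledDeviation (c : ℝ) (θ : ℝ → L2) (t : ℝ) :
    inner ℝ oneL2 (scaledDeviation c θ t) = 0 := by
  rw [scaledDeviation, inner_smul_right, inner_sub_right, inner_smul_right,
    real_inner_self_eq_norm_sq, norm_oneL2]
  ring

/-- The mixed products integrate to zero because η has mean zero. This makes the alignment term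
comparable with the growth term c η in the derivative of the magnified deviation. -/
theorem integral_inner_diff_excess {m M : ℝ} {η : L2} (h0 : inner ℝ oneL2 η = 0) :
    Integrable (fun p : ℝ × ℝ => (η p.2 - η p.1) * (excess m M (η p.2) - excess m M (η p.1)))
        squareMeasure ∧
      ∫ p : ℝ × ℝ, (η p.2 - η p.1) * (excess m M (η p.2) - excess m M (η p.1)) ∂squareMeasure =
        2 * ∫ x, excess m M (η x) * η x ∂unitMeasure := by
  have hη := Lp.memLp η
  have hg := memLp_excess m M hη
  have iη : Integrable (fun x => η x) unitMeasure := hη.integrable one_le_two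
  have ig : Integrable (fun x => excess m M (η x)) unitMeasure := hg.integrable one_le_two
  have iηg : Integrable (fun x => excess m M (η x) * η x) unitMeasure := hg.integrable_mul hη
  rw [inner_oneL2] at h0
  have i1 := iηg.comp_fst unitMeasure
  have i2 := iηg.comp_snd unitMeasure
  have i3 := iη.mul_prod ig
  have i4 := ig.mul_prod iη
  have e : ∀ p : ℝ × ℝ, (η p.2 - η p.1) * (excess m M (η p.2) - excess m M (η p.1)) =
      excess m M (η p.1) * η p.1 + excess m M (η p.2) * η p.2 -
        (η p.1 * excess m M (η p.2) + excess m M (η p.1) * η p.2) := fun p => by ring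
  simp_rw [e]
  refine ⟨(i1.fun_add i2).sub (i3.fun_add i4), ?_⟩
  rw [integral_sub (i1.fun_add i2) (i3.fun_add i4), integral_add i1 i2, integral_add i3 i4,
    integral_prod_mul (fun x => η x) (fun x => excess m M (η x)),
    integral_prod_mul (fun x => excess m M (η x)) (fun x => η x),
    integral_fun_fst (fun x => excess m M (η x) * η x),
    integral_fun_snd (fun x => excess m M (η x) * η x), h0]
  simp
  ring

/-- The inequality behind the decay of the diameter. -/
theorem inner_excess_velocity_le {K α κ ν D d C c t m M : ℝ} {W : ℝ → ℝ → ℝ}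
    (hα : 0 ≤ α ∧ α < 1) (hκ : 0 < κ) (hW : IsAdmissible K W) (hr : 0 ≤ alignRate d)
    (hC0 : 0 ≤ C)
    (hC : ∀ a b s : ℝ, 0 ≤ a * b → |b| ≤ s → |a| ≤ D + s →
      alignRate d * (a * b) - C * s ^ 2 ≤ coupling α a * b)
    (hD : 0 ≤ D) (hmM : m ≤ M) (hMD : M - m ≤ D) (hc : c = κ * alignRate d) (ht : 0 ≤ t)
    {θ : ℝ → L2} {v : L2} (hv : (v : ℝ → ℝ) =ᵐ[unitMeasure] velocity α κ W (fun _ => ν) (θ t)) :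
    2 * inner ℝ (excessL2 m M (scaledDeviation c θ t)) (c • scaledDeviation c θ t
      + Real.exp (c * t) • (v - (inner ℝ oneL2 v : ℝ) • oneL2)) ≤
      4 * κ * C * K * excessEnergy m M (scaledDeviation c θ t) := by
  set η := scaledDeviation c θ t with hη
  set g : ℝ → ℝ := fun x => excess m M (η x) with hg
  set E := Real.exp (c * t) with hE
  have hc0 : 0 ≤ c := by rw [hc]; positivity
  have hE1 : 1 ≤ E := Real.one_le_exp (by positivity)
  have hE0 : 0 < E := by linarith
  have hgm : MemLp g 2 unitMeasure := memLp_excess m M (Lp.memLp η)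
  have hum := (Lp.memLp (θ t)).1
  have hmean : (inner ℝ oneL2 v : ℝ) = ν := by
    rw [inner_oneL2]; exact integral_velocity hα hW hum hv
  -- the tested velocity
  have h1 : inner ℝ (excessL2 m M η) (v - (inner ℝ oneL2 v : ℝ) • oneL2) =
      -(κ / 2) * ∫ p : ℝ × ℝ, W p.1 p.2 * coupling α (θ t p.2 - θ t p.1) * (g p.2 - g p.1)
        ∂squareMeasure := by
    have h2 := integral_mul_velocity hα hW hum hgm hv
    have h3 := integral_prod_antisymm (coupling_kernel_antisymm (α := α) hW (θ t))
      (hW.integrable_coupling_mul hα hum hgm)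
    rw [hmean, inner_sub_right, inner_smul_right, real_inner_comm oneL2, inner_oneL2,
      inner_excessL2, integral_congr_ae (coeFn_excessL2 m M η)]
    change ∫ x, g x * v x ∂unitMeasure - ν * ∫ x, g x ∂unitMeasure = _
    rw [h2, h3]
    ring
  obtain ⟨i2, h2⟩ := integral_inner_diff_excess (m := m) (M := M)
    (inner_oneL2_scaledDeviation c θ t)
  have i3 := hW.integrable_mul_sq_add_sq hgm
  have i1 := hW.integrable_coupling_mul_diff hα hum hgm
  have hdev := coeFn_scaledDeviation c θ t
  have hle : ∫ p : ℝ × ℝ, (alignRate d * ((η p.2 - η p.1) * (g p.2 - g p.1))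
      - 2 * C * (W p.1 p.2 * (g p.1 ^ 2 + g p.2 ^ 2))) ∂squareMeasure ≤
      ∫ p : ℝ × ℝ, E * (W p.1 p.2 * coupling α (θ t p.2 - θ t p.1) * (g p.2 - g p.1))
        ∂squareMeasure := by
    refine integral_mono_ae ((i2.const_mul _).sub (i3.const_mul _)) (i1.const_mul _) ?_
    filter_upwards [hW.one_le, Measure.quasiMeasurePreserving_fst.ae hdev,
      Measure.quasiMeasurePreserving_snd.ae hdev] with p hp hp1 hp2
    have ha : η p.2 - η p.1 = E * (θ t p.2 - θ t p.1) := by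
      rw [hp1, hp2]; ring
    set a := θ t p.2 - θ t p.1
    set b := g p.2 - g p.1 with hb
    have hab : 0 ≤ (η p.2 - η p.1) * b := excess_diff_mul_nonneg hmM (η p.1) (η p.2)
    have habs := abs_sub_le_excess hmM (η p.1) (η p.2)
    change _ ≤ _ + (|g p.1| + |g p.2|) at habs
    set s := |g p.1| + |g p.2| with hs
    have hs0 : 0 ≤ s := by positivity
    have hbs : |b| ≤ s := by
      rw [hs, add_comm]; exact abs_sub _ _
    -- The phase difference a is not magnified whereas b and s are, hence the division by E. Since E
    -- ≥ 1, (D + s)/E ≤ D + s/E.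
    have hcl := hC a (b / E) (s / E) (by
        have : a * (b / E) = ((η p.2 - η p.1) * b) / E ^ 2 := by rw [ha]; field_simp
        rw [this]; positivity)
      (by rw [abs_div, abs_of_pos hE0]; gcongr)
      (by
        have h4 : |a| = |η p.2 - η p.1| / E := by
          rw [ha, abs_mul, abs_of_pos hE0]; field_simp
        rw [h4, div_le_iff₀ hE0, add_mul, div_mul_cancel₀ _ hE0.ne']
        nlinarith)
    have hcl2 : alignRate d * ((η p.2 - η p.1) * b) - C * s ^ 2 ≤ E * (coupling α a * b) := by
      have h5 := mul_le_mul_of_nonneg_left hcl (sq_nonneg E)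
      have e1 : E ^ 2 * (alignRate d * (a * (b / E)) - C * (s / E) ^ 2) =
          alignRate d * ((η p.2 - η p.1) * b) - C * s ^ 2 := by
        rw [ha]; field_simp
      have e2 : E ^ 2 * (coupling α a * (b / E)) = E * (coupling α a * b) := by field_simp
      rwa [e1, e2] at h5
    have hs2 : s ^ 2 ≤ 2 * (g p.1 ^ 2 + g p.2 ^ 2) := by
      rw [hs, ← sq_abs (g p.1), ← sq_abs (g p.2)]
      nlinarith [sq_nonneg (|g p.1| - |g p.2|)]
    have h6 := mul_le_mul_of_nonneg_left hcl2 (hW.nonneg p.1 p.2)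
    -- The product has a sign by monotonicity of `excess`, so W ≥ 1 can be dropped from it. The
    -- error in s² keeps its weight and is controlled by the row bound.
    have h7 : alignRate d * ((η p.2 - η p.1) * b) ≤
        W p.1 p.2 * (alignRate d * ((η p.2 - η p.1) * b)) :=
      le_mul_of_one_le_left (mul_nonneg hr hab) hp
    have h8 := mul_le_mul_of_nonneg_left hs2 (mul_nonneg hC0 (hW.nonneg p.1 p.2))
    linarith
  rw [integral_sub (i2.const_mul _) (i3.const_mul _), integral_const_mul, integral_const_mul,
    integral_const_mul, h2] at hle
  have h9 := hW.integral_mul_sq_add_sq_le hgm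
  rw [inner_add_right, inner_smul_right, inner_smul_right, h1, inner_excessL2]
  change 2 * (c * ∫ x, g x * η x ∂unitMeasure + _) ≤ 4 * κ * C * K * ∫ x, g x ^ 2 ∂unitMeasure
  have h10 := mul_le_mul_of_nonneg_left hle hκ.le
  have h11 := mul_le_mul_of_nonneg_left h9 (mul_nonneg hκ.le hC0)
  -- With c = κ * `alignRate d` the growth term and the alignment term cancel exactly; only the
  -- quadratic error survives.
  rw [hc]
  nlinarith

/-- Exponential decay of the diameter of a solution with constant natural frequency. -/
theorem IsSolution.diameter_decay {K α κ ν D d : ℝ} {W : ℝ → ℝ → ℝ} {T : ℝ≥0∞} {θin : L2}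
    {θ : ℝ → L2} (hα : 0 ≤ α ∧ α < 1) (hκ : 0 < κ) (hD : 0 < D) (hDd : D < d) (hd : d < Real.pi)
    (hW : IsAdmissible K W) (hθ : IsSolution α κ W (fun _ => ν) θin T θ)
    (hdiam : diameter θin ≤ ENNReal.ofReal D) {t : ℝ} (ht : t ∈ timeInterval T) :
    ∀ᵐ p ∂squareMeasure, |θ t p.2 - θ t p.1| ≤ D * Real.exp (-(κ * alignRate d * t)) := by
  have hr := alignRate_pos (hD.trans hDd) hd
  obtain ⟨C, hC0, hC⟩ := exists_coupling_mul_ge hD hDd hd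
  obtain ⟨m₀, hm₀⟩ := exists_bounds_of_diameter hD.le hdiam
  set c := κ * alignRate d with hc
  set μ₀ : ℝ := inner ℝ oneL2 θin
  set m := m₀ - μ₀
  have hmM : m ≤ m + D := by linarith
  have hsub : Set.Icc 0 t ⊆ timeInterval T := fun s hs =>
    ⟨hs.1, (ENNReal.ofReal_le_ofReal hs.2).trans_lt ht.2⟩
  have h0 : excessEnergy m (m + D) (scaledDeviation c θ 0) = 0 := by
    rw [excessEnergy_eq_zero hmM]
    filter_upwards [coeFn_scaledDeviation c θ 0, hm₀] with x hx hx'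
    rw [hx, hθ.initial]
    simp only [mul_zero, Real.exp_zero, one_mul]
    constructor <;> linarith [hx'.1, hx'.2]
  have hA : 0 ≤ 4 * κ * C * |K| := by positivity
  -- With B = 0 and zero initial energy, the energy stays zero. The summand 1 only ensures A ≠ 0.
  have hgr := gronwall_of_interior (f := fun t => excessEnergy m (m + D) (scaledDeviation c θ t))
    (A := 4 * κ * C * |K| + 1) (B := 0) (by linarith) ht.1
    ((continuous_excessEnergy hmM).comp_continuousOn
      (continuousOn_scaledDeviation c (hθ.continuousOn.mono hsub)))
    (by
      intro τ hτ
      obtain ⟨v, hv, hv'⟩ := hθ.equation τ (hsub ⟨hτ.1.le, hτ.2.le⟩) hτ.1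
      refine ⟨_, hasDerivAt_excessEnergy hmM (hasDerivAt_scaledDeviation hv'), ?_⟩
      have h1 := inner_excess_velocity_le hα hκ hW hr.le hC0 (hC α hα) hD.le hmM
        (by linarith) hc hτ.1.le hv
      have h2 := excessEnergy_nonneg m (m + D) (scaledDeviation c θ τ)
      have h3 : 4 * κ * C * K ≤ 4 * κ * C * |K| := by
        have := le_abs_self K
        gcongr
      nlinarith)
  simp only [h0, zero_div, add_zero, mul_zero] at hgr
  have hz := le_antisymm hgr (excessEnergy_nonneg _ _ _)
  rw [excessEnergy_eq_zero hmM] at hz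
  have hdev : ∀ᵐ x ∂unitMeasure, m ≤ Real.exp (c * t) * (θ t x - inner ℝ oneL2 (θ t)) ∧
      Real.exp (c * t) * (θ t x - inner ℝ oneL2 (θ t)) ≤ m + D := by
    filter_upwards [hz, coeFn_scaledDeviation c θ t] with x hx hx'
    rwa [hx'] at hx
  filter_upwards [Measure.quasiMeasurePreserving_fst.ae hdev,
      Measure.quasiMeasurePreserving_snd.ae hdev] with p hp1 hp2
  rw [Real.exp_neg, ← div_eq_mul_inv, le_div_iff₀ (Real.exp_pos _)]
  have h1 : |θ t p.2 - θ t p.1| * Real.exp (c * t) = |Real.exp (c * t) * (θ t p.2 - θ t p.1)| := by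
    rw [abs_mul, abs_of_pos (Real.exp_pos _), mul_comm]
  rw [h1, abs_le]
  constructor <;> linarith [hp1.1, hp1.2, hp2.1, hp2.2]

/-! ### The singular kernel and its cell averages -/

section StepKernel

/-! ### The singular weight -/

theorem integrableOn_abs_rpow {β : ℝ} (hβ : β < 1) :
    IntegrableOn (fun z : ℝ => 1 / |z| ^ β) (Set.Icc (-1) 1) volume := by
  have h1 : IntegrableOn (fun z : ℝ => 1 / |z| ^ β) (Set.Icc 0 1) volume := by
    have := (intervalIntegral.intervalIntegrable_rpow' (a := 0) (b := 1) (r := -β)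
      (by linarith)).1
    rw [integrableOn_Icc_iff_integrableOn_Ioc]
    refine this.congr_fun (fun z hz => ?_) measurableSet_Ioc
    simp only [abs_of_pos hz.1, Real.rpow_neg hz.1.le, one_div]
  have h2 : IntegrableOn (fun z : ℝ => 1 / |z| ^ β) (Set.Icc (-1) 0) volume := by
    have := ((Measure.measurePreserving_neg (volume : Measure ℝ)).integrableOn_comp_preimage
      (Homeomorph.neg ℝ).measurableEmbedding).2 h1
    simpa [Function.comp_def] using this
  have h3 := h2.union h1
  rwa [Set.Icc_union_Icc_eq_Icc (by norm_num) (by norm_num)] at h3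

/-- A bound for the row integrals of the singular weight. -/
def weightBound (β : ℝ) : ℝ := ∫ z in Set.Icc (-1 : ℝ) 1, 1 / |z| ^ β

/-- Reflecting and translating y to x - y moves the row into the fixed interval [-1, 1], so the
bound is uniform in x. -/
theorem weight_row {β x : ℝ} (hβ : β < 1) (hx : x ∈ Set.Icc (0 : ℝ) 1) :
    Integrable (weight β x) unitMeasure ∧ ∫ y, weight β x y ∂unitMeasure ≤ weightBound β := by
  have hmp := Measure.measurePreserving_sub_left (volume : Measure ℝ) x
  have hemb := (Homeomorph.subLeft x).measurableEmbedding
  have h1 : IntegrableOn (weight β x) ((fun y => x - y) ⁻¹' Set.Icc (-1) 1) volume :=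
    (hmp.integrableOn_comp_preimage hemb).2 (integrableOn_abs_rpow hβ)
  have h2 : ∫ y in (fun y => x - y) ⁻¹' Set.Icc (-1) 1, weight β x y = weightBound β :=
    hmp.setIntegral_preimage_emb hemb (fun z : ℝ => 1 / |z| ^ β) _
  have hsub : Set.Icc (0 : ℝ) 1 ⊆ (fun y => x - y) ⁻¹' Set.Icc (-1) 1 := by
    intro y hy
    constructor <;> linarith [hx.1, hx.2, hy.1, hy.2]
  refine ⟨h1.mono_set hsub, ?_⟩
  rw [← h2]
  refine setIntegral_mono_set h1 (Eventually.of_forall fun y => ?_) hsub.eventuallyLE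
  exact div_nonneg zero_le_one (Real.rpow_nonneg (abs_nonneg _) _)

theorem isAdmissible_weight {β : ℝ} (hβ : 0 ≤ β ∧ β < 1) :
    IsAdmissible (weightBound β) (weight β) where
  measurable := by
    change Measurable fun p : ℝ × ℝ => 1 / |p.1 - p.2| ^ β
    exact measurable_const.div (((measurable_fst.sub measurable_snd).abs).pow_const β)
  symm x y := by simp only [weight, abs_sub_comm]
  nonneg x y := div_nonneg zero_le_one (Real.rpow_nonneg (abs_nonneg _) _)
  one_le := by
    have hI : ∀ᵐ x ∂unitMeasure, x ∈ Set.Icc (0 : ℝ) 1 := ae_restrict_mem measurableSet_Icc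
    -- On the diagonal the formula gives 1 / 0 = 0 when β > 0, so the lower bound 1 can hold only
    -- off this null set.
    have hne : ∀ᵐ p ∂squareMeasure, p ∈ {p : ℝ × ℝ | p.1 ≠ p.2} := by
      have hms : MeasurableSet {p : ℝ × ℝ | p.1 ≠ p.2} :=
        (measurableSet_eq_fun measurable_fst measurable_snd).compl
      rw [Measure.ae_prod_mem_iff_ae_ae_mem hms]
      refine Eventually.of_forall fun x => ?_
      filter_upwards [(measure_eq_zero_iff_ae_notMem.1 (measure_singleton x) :
        ∀ᵐ y ∂unitMeasure, y ∉ ({x} : Set ℝ))] with y hy h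
      exact hy h.symm
    filter_upwards [hne, Measure.quasiMeasurePreserving_fst.ae hI,
      Measure.quasiMeasurePreserving_snd.ae hI] with p hp h1 h2
    have h3 : 0 < |p.1 - p.2| := abs_pos.2 (sub_ne_zero.2 hp)
    have h4 : |p.1 - p.2| ≤ 1 := by
      rw [abs_le]; constructor <;> linarith [h1.1, h1.2, h2.1, h2.2]
    rw [weight, le_div_iff₀ (Real.rpow_pos_of_pos h3 _), one_mul]
    exact Real.rpow_le_one h3.le h4 hβ.1
  integrable_row := by
    filter_upwards [ae_restrict_mem measurableSet_Icc] with x hx using (weight_row hβ.2 hx).1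
  row_le := by
    filter_upwards [ae_restrict_mem measurableSet_Icc] with x hx using (weight_row hβ.2 hx).2

/-! ### The partition into cells -/

variable {N : ℕ}

theorem cell_bounds {i : Fin N} {x : ℝ} (hx : x ∈ cell N i) :
    (i : ℝ) / N ≤ x ∧ x ≤ ((i : ℝ) + 1) / N := by
  unfold cell at hx
  split_ifs at hx with h
  · simp only [h, Nat.cast_zero, zero_div, zero_add]
    exact hx
  · exact ⟨hx.1.le, hx.2⟩

theorem cell_lt {i : Fin N} {x : ℝ} (hx : x ∈ cell N i) (hi : (i : ℕ) ≠ 0) : (i : ℝ) / N < x := by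
  unfold cell at hx
  rw [if_neg hi] at hx
  exact hx.1

theorem cell_subset (i : Fin N) : cell N i ⊆ Set.Icc 0 1 := by
  intro x hx
  have hN : 0 < (N : ℝ) := by exact_mod_cast i.pos
  have h := cell_bounds hx
  refine ⟨le_trans (by positivity) h.1, h.2.trans ?_⟩
  rw [div_le_one hN]
  exact_mod_cast i.isLt

theorem cell_disjoint_of_lt {i j : Fin N} (hij : i < j) : Disjoint (cell N i) (cell N j) := by
  rw [Set.disjoint_left]
  intro x hi hj
  have hN : 0 < (N : ℝ) := by exact_mod_cast i.pos
  have hij' : (i : ℕ) + 1 ≤ j := hij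
  have h1 := cell_lt hj (by omega)
  have h2 := (cell_bounds hi).2
  have h3 : ((i : ℝ) + 1) / N ≤ (j : ℝ) / N := by
    gcongr
    exact_mod_cast hij'
  linarith

theorem pairwise_disjoint_cell : Pairwise (Function.onFun Disjoint (cell N)) := by
  intro i j hij
  rcases lt_or_gt_of_ne hij with h | h
  · exact cell_disjoint_of_lt h
  · exact (cell_disjoint_of_lt h).symm

theorem exists_mem_cell (hN : 1 ≤ N) {x : ℝ} (hx : x ∈ Set.Icc (0 : ℝ) 1) :
    ∃ i, x ∈ cell N i := by
  have hN' : 0 < (N : ℝ) := by exact_mod_cast hN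
  by_cases h : x ≤ 1 / N
  · exact ⟨⟨0, hN⟩, by simp only [cell, if_true]; exact ⟨hx.1, h⟩⟩
  · push Not at h
    have h1 : 1 < N * x := by rwa [div_lt_iff₀ hN', mul_comm] at h
    have h2 : 1 < ⌈(N : ℝ) * x⌉₊ := by
      rw [Nat.lt_ceil]; exact_mod_cast h1
    have h3 : ⌈(N : ℝ) * x⌉₊ ≤ N := by
      rw [Nat.ceil_le]
      nlinarith [hx.2]
    have h4 := Nat.ceil_lt_add_one (by linarith : 0 ≤ (N : ℝ) * x)
    have h5 := Nat.le_ceil ((N : ℝ) * x)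
    -- The cells are closed on the right and numbered from 0, so x lies in the cell of index ⌈N x⌉ -
    -- 1.
    obtain ⟨n, hn⟩ : ∃ n, ⌈(N : ℝ) * x⌉₊ = n + 1 := ⟨⌈(N : ℝ) * x⌉₊ - 1, by omega⟩
    rw [hn] at h2 h3 h4 h5
    push_cast at h4 h5
    refine ⟨⟨n, by omega⟩, ?_⟩
    simp only [cell]
    rw [if_neg (by omega)]
    constructor
    · rw [div_lt_iff₀ hN']; linarith
    · rw [le_div_iff₀ hN']; linarith

theorem iUnion_cell (hN : 1 ≤ N) : ⋃ i, cell N i = Set.Icc (0 : ℝ) 1 := by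
  refine Set.Subset.antisymm (Set.iUnion_subset cell_subset) fun x hx => ?_
  exact Set.mem_iUnion.2 (exists_mem_cell hN hx)

theorem volume_cell (i : Fin N) : volume (cell N i) = ENNReal.ofReal (1 / N) := by
  unfold cell
  split_ifs
  · rw [Real.volume_Icc, sub_zero]
  · rw [Real.volume_Ioc]
    congr 1
    ring

theorem volume_real_cell (i : Fin N) : volume.real (cell N i) = 1 / N := by
  rw [Measure.real, volume_cell, ENNReal.toReal_ofReal (by positivity)]

theorem volume_real_box (i k : Fin N) :
    (volume : Measure (ℝ × ℝ)).real (cell N i ×ˢ cell N k) = 1 / (N : ℝ) ^ 2 := by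
  rw [Measure.real, Measure.volume_eq_prod, Measure.prod_prod, volume_cell, volume_cell,
    ENNReal.toReal_mul, ENNReal.toReal_ofReal (by positivity)]
  field_simp

theorem volume_box_ne_top (i k : Fin N) :
    (volume : Measure (ℝ × ℝ)) (cell N i ×ˢ cell N k) ≠ ∞ := by
  rw [Measure.volume_eq_prod, Measure.prod_prod, volume_cell, volume_cell]
  exact ENNReal.mul_ne_top ENNReal.ofReal_ne_top ENNReal.ofReal_ne_top

theorem volume_box_ne_zero (i k : Fin N) :
    (volume : Measure (ℝ × ℝ)) (cell N i ×ˢ cell N k) ≠ 0 := by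
  have hN : 0 < (N : ℝ) := by exact_mod_cast i.pos
  intro h
  have := volume_real_box i k
  rw [Measure.real, h, ENNReal.toReal_zero] at this
  have h2 : 0 < 1 / (N : ℝ) ^ 2 := by positivity
  linarith

theorem measurableSet_box (i k : Fin N) : MeasurableSet (cell N i ×ˢ cell N k) :=
  (measurableSet_cell N i).prod (measurableSet_cell N k)

theorem squareMeasure_eq_restrict :
    squareMeasure = volume.restrict (Set.Icc (0 : ℝ) 1 ×ˢ Set.Icc (0 : ℝ) 1) := by
  rw [squareMeasure, unitMeasure, Measure.prod_restrict, ← Measure.volume_eq_prod]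

theorem box_subset (i k : Fin N) :
    cell N i ×ˢ cell N k ⊆ Set.Icc (0 : ℝ) 1 ×ˢ Set.Icc (0 : ℝ) 1 :=
  Set.prod_mono (cell_subset i) (cell_subset k)

theorem iUnion_box (hN : 1 ≤ N) :
    ⋃ q : Fin N × Fin N, cell N q.1 ×ˢ cell N q.2 = Set.Icc (0 : ℝ) 1 ×ˢ Set.Icc (0 : ℝ) 1 := by
  refine Set.Subset.antisymm (Set.iUnion_subset fun q => box_subset q.1 q.2) fun p hp => ?_
  obtain ⟨i, hi⟩ := exists_mem_cell hN hp.1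
  obtain ⟨k, hk⟩ := exists_mem_cell hN hp.2
  exact Set.mem_iUnion.2 ⟨(i, k), hi, hk⟩

theorem pairwise_disjoint_box :
    Pairwise (Function.onFun Disjoint fun q : Fin N × Fin N => cell N q.1 ×ˢ cell N q.2) := by
  intro q r hqr
  simp only [Function.onFun, Set.disjoint_prod]
  by_cases h : q.1 = r.1
  · right
    exact pairwise_disjoint_cell fun h2 => hqr (Prod.ext h h2)
  · left
    exact pairwise_disjoint_cell h

theorem integrableOn_box {F : ℝ × ℝ → ℝ} (hF : Integrable F squareMeasure) (i k : Fin N) :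
    IntegrableOn F (cell N i ×ˢ cell N k) volume := by
  rw [squareMeasure_eq_restrict] at hF
  exact IntegrableOn.mono_set hF (box_subset i k)

theorem integral_square_eq_sum (hN : 1 ≤ N) {F : ℝ × ℝ → ℝ} (hF : Integrable F squareMeasure) :
    ∫ p, F p ∂squareMeasure =
      ∑ q : Fin N × Fin N, ∫ p in cell N q.1 ×ˢ cell N q.2, F p := by
  have hi : ∀ q : Fin N × Fin N, IntegrableOn F (cell N q.1 ×ˢ cell N q.2) volume :=
    fun q => integrableOn_box hF q.1 q.2
  have hm : ∀ q : Fin N × Fin N, MeasurableSet (cell N q.1 ×ˢ cell N q.2) :=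
    fun q => measurableSet_box q.1 q.2
  rw [squareMeasure_eq_restrict, ← iUnion_box hN,
    integral_iUnion_fintype hm pairwise_disjoint_box hi]

/-! ### Averaging over the cells -/

theorem stepKernel_of_mem {W : ℝ → ℝ → ℝ} {i k : Fin N} {x y : ℝ} (hx : x ∈ cell N i)
    (hy : y ∈ cell N k) :
    stepKernel N W x y = ⨍ p in cell N i ×ˢ cell N k, W p.1 p.2 := by
  have hnot : ∀ {j l : Fin N} {z : ℝ}, z ∈ cell N l → j ≠ l → z ∉ cell N j := fun hz hjl hz' =>
    Set.disjoint_left.1 (pairwise_disjoint_cell hjl) hz' hz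
  rw [stepKernel, Finset.sum_eq_single i, Finset.sum_eq_single k, Set.indicator_of_mem]
  · exact ⟨hx, hy⟩
  · intro l _ hl
    exact Set.indicator_of_notMem (fun h => hnot hy hl h.2) _
  · simp
  · intro j _ hj
    exact Finset.sum_eq_zero fun l _ => Set.indicator_of_notMem (fun h => hnot hx hj h.1) _
  · simp

theorem average_box (W : ℝ → ℝ → ℝ) (i k : Fin N) :
    ⨍ p in cell N i ×ˢ cell N k, W p.1 p.2 =
      (N : ℝ) ^ 2 * ∫ p in cell N i ×ˢ cell N k, W p.1 p.2 := by
  rw [setAverage_eq, volume_real_box, smul_eq_mul, one_div, inv_inv]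

theorem stepKernel_nonneg {W : ℝ → ℝ → ℝ} (hW : ∀ x y, 0 ≤ W x y) (x y : ℝ) :
    0 ≤ stepKernel N W x y := by
  refine Finset.sum_nonneg fun i _ => Finset.sum_nonneg fun k _ => ?_
  refine Set.indicator_nonneg (fun _ _ => ?_) _
  rw [average_box]
  have : 0 ≤ ∫ p in cell N i ×ˢ cell N k, W p.1 p.2 := integral_nonneg fun p => hW _ _
  positivity

theorem stepKernel_symm {W : ℝ → ℝ → ℝ} (hW : ∀ x y, W x y = W y x) (x y : ℝ) :
    stepKernel N W x y = stepKernel N W y x := by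
  have h : ∀ i k : Fin N, ⨍ p in cell N i ×ˢ cell N k, W p.1 p.2 =
      ⨍ p in cell N k ×ˢ cell N i, W p.1 p.2 := by
    intro i k
    rw [average_box, average_box, Measure.volume_eq_prod,
      ← setIntegral_prod_swap (cell N i) (cell N k) fun p : ℝ × ℝ => W p.1 p.2]
    simp_rw [Prod.fst_swap, Prod.snd_swap, fun p : ℝ × ℝ => hW p.2 p.1]
  unfold stepKernel
  rw [Finset.sum_comm]
  refine Finset.sum_congr rfl fun k _ => Finset.sum_congr rfl fun i _ => ?_
  rw [h i k]
  by_cases hx : x ∈ cell N i <;> by_cases hy : y ∈ cell N k <;>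
    simp [Set.indicator, hx, hy]

theorem measurable_stepKernel (N : ℕ) (W : ℝ → ℝ → ℝ) :
    Measurable (Function.uncurry (stepKernel N W)) := by
  change Measurable fun p : ℝ × ℝ => ∑ i, ∑ k, (cell N i ×ˢ cell N k).indicator
    (fun _ => ⨍ p in cell N i ×ˢ cell N k, W p.1 p.2) p
  exact Finset.measurable_sum _ fun i _ => Finset.measurable_sum _ fun k _ =>
    measurable_const.indicator (measurableSet_box i k)

theorem integrable_stepKernel (N : ℕ) (W : ℝ → ℝ → ℝ) :
    Integrable (fun p : ℝ × ℝ => stepKernel N W p.1 p.2) squareMeasure := by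
  unfold stepKernel
  exact integrable_finsetSum _ fun i _ => integrable_finsetSum _ fun k _ =>
    (integrable_const _).indicator (measurableSet_box i k)

/-- A row integral of the step kernel is the average of the row integrals of W over the cell
containing x, so the same K works for every N. -/
theorem stepKernel_row {W : ℝ → ℝ → ℝ} {K : ℝ} (hN : 1 ≤ N) (hW : IsAdmissible K W) {x : ℝ}
    (hx : x ∈ Set.Icc (0 : ℝ) 1) :
    Integrable (stepKernel N W x) unitMeasure ∧ ∫ y, stepKernel N W x y ∂unitMeasure ≤ K := by
  have hN' : 0 < (N : ℝ) := by exact_mod_cast hN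
  obtain ⟨i, hi⟩ := exists_mem_cell hN hx
  have hint : Integrable (stepKernel N W x) unitMeasure := by
    have hm : Measurable (stepKernel N W x) := (measurable_stepKernel N W).of_uncurry_left
    change Integrable (fun y => ∑ i, ∑ k, (cell N i ×ˢ cell N k).indicator
      (fun _ => ⨍ p in cell N i ×ˢ cell N k, W p.1 p.2) (x, y)) unitMeasure
    refine integrable_finsetSum _ fun j _ => integrable_finsetSum _ fun k _ => ?_
    exact (integrable_const (⨍ p in cell N j ×ˢ cell N k, W p.1 p.2)).indicator
      (measurable_prodMk_left (measurableSet_box j k))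
  refine ⟨hint, ?_⟩
  have h1 : ∫ y, stepKernel N W x y ∂unitMeasure =
      N * ∑ k, ∫ p in cell N i ×ˢ cell N k, W p.1 p.2 := by
    rw [unitMeasure, ← iUnion_cell hN, integral_iUnion_fintype (measurableSet_cell N)
      pairwise_disjoint_cell (fun k => IntegrableOn.mono_set hint (cell_subset k)), Finset.mul_sum]
    refine Finset.sum_congr rfl fun k _ => ?_
    rw [setIntegral_congr_fun (measurableSet_cell N k) (fun y hy => stepKernel_of_mem hi hy),
      setIntegral_const, volume_real_cell, average_box, smul_eq_mul]
    field_simp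
  have hW' := hW.integrable
  have hWi : IntegrableOn (fun p : ℝ × ℝ => W p.1 p.2) (cell N i ×ˢ Set.Icc 0 1)
      (volume.prod volume) := by
    rw [squareMeasure_eq_restrict] at hW'
    exact IntegrableOn.mono_set hW' (Set.prod_mono (cell_subset i) subset_rfl)
  have h2 : ∑ k, ∫ p in cell N i ×ˢ cell N k, W p.1 p.2 =
      ∫ z in cell N i, ∫ y, W z y ∂unitMeasure := by
    have hd : Pairwise (Function.onFun Disjoint fun k => cell N i ×ˢ cell N k) :=
      fun k l hkl => Set.disjoint_prod.2 (Or.inr (pairwise_disjoint_cell hkl))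
    rw [← setIntegral_prod _ hWi, ← iUnion_cell hN, Set.prod_iUnion, ← Measure.volume_eq_prod,
      integral_iUnion_fintype (fun k => measurableSet_box i k) hd
        (fun k => integrableOn_box hW' i k)]
  have h3 : ∫ z in cell N i, ∫ y, W z y ∂unitMeasure ≤ ∫ _ in cell N i, K := by
    refine integral_mono_ae ?_ (integrable_const_iff.2 (Or.inr ?_)) ?_
    · exact IntegrableOn.mono_set hW'.integral_prod_left (cell_subset i)
    · rw [isFiniteMeasure_restrict, volume_cell]
      exact ENNReal.ofReal_ne_top
    · exact ae_restrict_of_ae_restrict_of_subset (cell_subset i) hW.row_le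
  rw [setIntegral_const, volume_real_cell, smul_eq_mul] at h3
  rw [h1, h2]
  calc (N : ℝ) * ∫ z in cell N i, ∫ y, W z y ∂unitMeasure ≤ N * (1 / N * K) := by gcongr
    _ = K := by field_simp

theorem isAdmissible_stepKernel {W : ℝ → ℝ → ℝ} {K : ℝ} (hN : 1 ≤ N) (hW : IsAdmissible K W) :
    IsAdmissible K (stepKernel N W) where
  measurable := measurable_stepKernel N W
  symm := stepKernel_symm hW.symm
  nonneg := stepKernel_nonneg hW.nonneg
  one_le := by
    have hone := hW.one_le
    rw [squareMeasure_eq_restrict] at hone ⊢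
    filter_upwards [ae_restrict_mem (measurableSet_Icc.prod measurableSet_Icc)] with p hp
    obtain ⟨i, hi⟩ := exists_mem_cell hN hp.1
    obtain ⟨k, hk⟩ := exists_mem_cell hN hp.2
    rw [stepKernel_of_mem hi hk]
    exact (convex_Ici (1 : ℝ)).set_average_mem isClosed_Ici (volume_box_ne_zero i k)
      (volume_box_ne_top i k) (ae_restrict_of_ae_restrict_of_subset (box_subset i k) hone)
      (integrableOn_box hW.integrable i k)
  integrable_row := by
    filter_upwards [ae_restrict_mem measurableSet_Icc] with x hx
      using (stepKernel_row hN hW hx).1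
  row_le := by
    filter_upwards [ae_restrict_mem measurableSet_Icc] with x hx
      using (stepKernel_row hN hW hx).2

/-- Averaging is a contraction of `L¹(Ω²)`. -/
theorem kernelDist_stepKernel_stepKernel_le (hN : 1 ≤ N) {V W : ℝ → ℝ → ℝ}
    (hV : Integrable (fun p : ℝ × ℝ => V p.1 p.2) squareMeasure)
    (hW : Integrable (fun p : ℝ × ℝ => W p.1 p.2) squareMeasure) :
    kernelDist (stepKernel N V) (stepKernel N W) ≤ kernelDist V W := by
  have hN' : 0 < (N : ℝ) := by exact_mod_cast hN
  unfold kernelDist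
  rw [integral_square_eq_sum hN (integrable_abs_kernel_sub (integrable_stepKernel N V)
    (integrable_stepKernel N W)), integral_square_eq_sum hN (integrable_abs_kernel_sub hV hW)]
  refine Finset.sum_le_sum fun q _ => ?_
  have h1 : ∫ p in cell N q.1 ×ˢ cell N q.2, |stepKernel N V p.1 p.2 - stepKernel N W p.1 p.2| =
      |∫ p in cell N q.1 ×ˢ cell N q.2, (V p.1 p.2 - W p.1 p.2)| := by
    rw [setIntegral_congr_fun (measurableSet_box q.1 q.2)
      (g := fun _ => |(⨍ p in cell N q.1 ×ˢ cell N q.2, V p.1 p.2)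
        - ⨍ p in cell N q.1 ×ˢ cell N q.2, W p.1 p.2|)
      (fun p hp => by simp only [stepKernel_of_mem hp.1 hp.2]), setIntegral_const, volume_real_box,
      average_box, average_box,
      integral_sub (integrableOn_box hV q.1 q.2) (integrableOn_box hW q.1 q.2), ← mul_sub, abs_mul,
      abs_of_nonneg (by positivity : 0 ≤ (N : ℝ) ^ 2), smul_eq_mul]
    field_simp
  rw [h1]
  exact abs_integral_le_integral_abs

theorem kernelDist_comm (V W : ℝ → ℝ → ℝ) : kernelDist V W = kernelDist W V := by
  unfold kernelDist
  simp_rw [abs_sub_comm]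

theorem kernelDist_triangle {U V W : ℝ → ℝ → ℝ}
    (hU : Integrable (fun p : ℝ × ℝ => U p.1 p.2) squareMeasure)
    (hV : Integrable (fun p : ℝ × ℝ => V p.1 p.2) squareMeasure)
    (hW : Integrable (fun p : ℝ × ℝ => W p.1 p.2) squareMeasure) :
    kernelDist U W ≤ kernelDist U V + kernelDist V W := by
  unfold kernelDist
  rw [← integral_add (integrable_abs_kernel_sub hU hV) (integrable_abs_kernel_sub hV hW)]
  exact integral_mono (hU.sub hW).abs ((hU.sub hV).abs.add (hV.sub hW).abs)
    fun p => abs_sub_le _ _ _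

/-- The cell averages of a continuous kernel converge. -/
theorem kernelDist_stepKernel_le_of_continuous {g : ℝ × ℝ → ℝ} (hg : Continuous g)
    {ε : ℝ} (hε : 0 < ε) :
    ∀ᶠ N : ℕ in atTop, kernelDist (stepKernel N fun x y => g (x, y)) (fun x y => g (x, y)) ≤ ε := by
  have hK : IsCompact (Set.Icc (0 : ℝ) 1 ×ˢ Set.Icc (0 : ℝ) 1) := isCompact_Icc.prod isCompact_Icc
  have huc := hK.uniformContinuousOn_of_continuous hg.continuousOn
  obtain ⟨δ, hδ, hgδ⟩ := Metric.uniformContinuousOn_iff_le.1 huc ε hε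
  obtain ⟨n, hn⟩ := exists_nat_gt (1 / δ)
  have hgi : Integrable g squareMeasure := by
    rw [squareMeasure_eq_restrict]
    exact hg.continuousOn.integrableOn_compact hK
  filter_upwards [eventually_ge_atTop (max n 1)] with N hN
  have hN1 : 1 ≤ N := (le_max_right _ _).trans hN
  have hN' : 0 < (N : ℝ) := by exact_mod_cast hN1
  have hNδ : 1 / (N : ℝ) ≤ δ := by
    rw [div_le_comm₀ hN' hδ]
    exact hn.le.trans (by exact_mod_cast (le_max_left _ _).trans hN)
  have hcell : ∀ {i : Fin N} {x y : ℝ}, x ∈ cell N i → y ∈ cell N i → dist x y ≤ δ := by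
    intro i x y hx hy
    have h1 := cell_bounds hx
    have h2 := cell_bounds hy
    rw [add_div] at h1 h2
    rw [Real.dist_eq, abs_le]
    constructor <;> linarith
  have hb : ∀ᵐ p ∂squareMeasure,
      |stepKernel N (fun x y => g (x, y)) p.1 p.2 - g (p.1, p.2)| ≤ ε := by
    rw [squareMeasure_eq_restrict]
    filter_upwards [ae_restrict_mem (measurableSet_Icc.prod measurableSet_Icc)] with p hp
    obtain ⟨i, hi⟩ := exists_mem_cell hN1 hp.1
    obtain ⟨k, hk⟩ := exists_mem_cell hN1 hp.2
    rw [stepKernel_of_mem hi hk, ← Real.dist_eq]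
    -- A closed ball is convex, so it contains the average of values lying in it.
    refine (convex_closedBall (g (p.1, p.2)) ε).set_average_mem Metric.isClosed_closedBall
      (volume_box_ne_zero i k) (volume_box_ne_top i k) ?_ (integrableOn_box hgi i k)
    filter_upwards [ae_restrict_mem (measurableSet_box i k)] with q hq
    exact hgδ q (box_subset i k hq) p hp (max_le (hcell hq.1 hi) (hcell hq.2 hk))
  calc _ ≤ ∫ _, ε ∂squareMeasure :=
        integral_mono_ae ((integrable_stepKernel N _).sub hgi).abs (integrable_const ε) hb
    _ = ε := by simp

/-- Approximate W in L¹ by a continuous g. Averaging is an L¹ contraction, so the approximation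
error is paid twice and the error of averaging g once: 3ε/4 in total. -/
theorem tendsto_kernelDist_stepKernel {W : ℝ → ℝ → ℝ}
    (hW : Integrable (fun p : ℝ × ℝ => W p.1 p.2) squareMeasure) :
    Tendsto (fun N => kernelDist (stepKernel N W) W) atTop (𝓝 0) := by
  rw [Metric.tendsto_atTop']
  intro ε hε
  obtain ⟨g, -, hg, hgc, hgi⟩ :=
    hW.exists_hasCompactSupport_integral_sub_le (by positivity : 0 < ε / 4)
  have hWg : kernelDist W (fun x y => g (x, y)) ≤ ε / 4 := hg
  have hev := kernelDist_stepKernel_le_of_continuous hgc (by positivity : 0 < ε / 4)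
  obtain ⟨n, hn⟩ := eventually_atTop.1 (hev.and (eventually_ge_atTop 1))
  refine ⟨n, fun N hN => ?_⟩
  obtain ⟨h1, hN1⟩ := hn N hN.le
  have h2 := (kernelDist_stepKernel_stepKernel_le hN1 hW hgi).trans hWg
  have h3 := kernelDist_triangle (integrable_stepKernel N W)
    (integrable_stepKernel N fun x y => g (x, y)) (W := fun x y => g (x, y)) hgi
  have h4 := kernelDist_triangle (integrable_stepKernel N W) (V := fun x y => g (x, y)) hgi hW
  rw [kernelDist_comm (fun x y => g (x, y)) W] at h4
  rw [Real.dist_eq, sub_zero, abs_of_nonneg (kernelDist_nonneg _ _)]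
  linarith

end StepKernel

/-! ### Stability in L² -/

theorem norm_sub_sq_eq_integral (u v : L2) :
    ‖u - v‖ ^ 2 = ∫ x, (u x - v x) ^ 2 ∂unitMeasure := by
  rw [norm_sq_eq_integral]
  refine integral_congr_ae ?_
  filter_upwards [Lp.coeFn_sub u v] with x hx
  rw [hx, Pi.sub_apply]

theorem inner_sub_sub_eq_integral (u v u' v' : L2) :
    inner ℝ (u - v) (u' - v') = ∫ x, (u x - v x) * (u' x - v' x) ∂unitMeasure := by
  rw [inner_eq_integral]
  refine integral_congr_ae ?_
  filter_upwards [Lp.coeFn_sub u v, Lp.coeFn_sub u' v'] with x hx hx'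
  rw [hx, hx', Pi.sub_apply, Pi.sub_apply]

theorem inner_oneL2_sub_eq_integral (u v : L2) :
    inner ℝ oneL2 (u - v) = ∫ x, (u x - v x) ∂unitMeasure := by
  rw [inner_oneL2]
  refine integral_congr_ae ?_
  filter_upwards [Lp.coeFn_sub u v] with x hx
  rw [hx, Pi.sub_apply]

theorem Icc_subset_timeInterval {T : ℝ≥0∞} {s t : ℝ} (hs : 0 ≤ s) (ht : t ∈ timeInterval T) :
    Set.Icc s t ⊆ timeInterval T := fun _ hr =>
  ⟨hs.trans hr.1, (ENNReal.ofReal_le_ofReal hr.2).trans_lt ht.2⟩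

/-- The exponential growth rate of the distance of two solutions. -/
def growthRate (κ K : ℝ) : ℝ := 4 * κ * Real.pi ^ 2 * |K| + 1

theorem growthRate_pos {κ K : ℝ} (hκ : 0 < κ) : 0 < growthRate κ K := by
  unfold growthRate
  positivity

/-- The stability constant on the time interval `[0, τ]`. -/
def stabilityConst (κ K τ : ℝ) : ℝ :=
  Real.exp (growthRate κ K * τ) * (1 + κ * Real.pi / growthRate κ K)

theorem stabilityConst_pos {κ K : ℝ} (τ : ℝ) (hκ : 0 < κ) : 0 < stabilityConst κ K τ := by
  have := growthRate_pos (K := K) hκ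
  have := Real.pi_pos
  unfold stabilityConst
  positivity

section Stability

variable {K α κ ν : ℝ} {V W : ℝ → ℝ → ℝ} {T : ℝ≥0∞} {θin θin' : L2} {θ θ' : ℝ → L2}

/-- Stability of solutions with respect to the kernel and the initial datum. -/
theorem IsSolution.norm_sub_sq_le (hα : 0 ≤ α ∧ α < 1) (hκ : 0 < κ) (hV : IsAdmissible K V)
    (hW : IsAdmissible K W) (hθ : IsSolution α κ V (fun _ => ν) θin T θ)
    (hθ' : IsSolution α κ W (fun _ => ν) θin' T θ') {t τ : ℝ} (ht : t ∈ timeInterval T)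
    (htτ : t ≤ τ) :
    ‖θ t - θ' t‖ ^ 2 ≤ stabilityConst κ K τ * (‖θin - θin'‖ ^ 2 + kernelDist V W) := by
  have hsub := Icc_subset_timeInterval le_rfl ht
  have hA := growthRate_pos (K := K) hκ
  have hk := kernelDist_nonneg V W
  have hpi := Real.pi_pos
  have hgr := gronwall_of_interior (f := fun t => ‖θ t - θ' t‖ ^ 2) (A := growthRate κ K)
    (B := κ * Real.pi * kernelDist V W) hA.ne' ht.1
    (((hθ.continuousOn.mono hsub).sub (hθ'.continuousOn.mono hsub)).norm.pow 2) (by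
      intro r hr
      obtain ⟨v, hv, hd⟩ := hθ.equation r (hsub ⟨hr.1.le, hr.2.le⟩) hr.1
      obtain ⟨v', hv', hd'⟩ := hθ'.equation r (hsub ⟨hr.1.le, hr.2.le⟩) hr.1
      refine ⟨_, (hd.sub hd').norm_sq, ?_⟩
      have h1 := integral_mul_velocity_sub_le hα hκ hV hW (Lp.memLp (θ r)) (Lp.memLp (θ' r))
        (Lp.memLp v) (Lp.memLp v') hv hv'
      rw [← inner_sub_sub_eq_integral, ← norm_sub_sq_eq_integral] at h1
      have h2 : 4 * κ * Real.pi ^ 2 * K ≤ growthRate κ K := by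
        have := le_abs_self K
        have : 4 * κ * Real.pi ^ 2 * K ≤ 4 * κ * Real.pi ^ 2 * |K| := by gcongr
        unfold growthRate
        linarith
      have h3 := mul_le_mul_of_nonneg_right h2 (sq_nonneg ‖θ r - θ' r‖)
      simp only [Pi.sub_apply]
      linarith)
  simp only [hθ.initial, hθ'.initial, sub_zero] at hgr
  set A := growthRate κ K
  have h4 : 0 ≤ κ * Real.pi * kernelDist V W / A := by positivity
  have h5 : Real.exp (A * t) ≤ Real.exp (A * τ) := by gcongr
  have h6 : ‖θin - θin'‖ ^ 2 + κ * Real.pi * kernelDist V W / A ≤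
      (1 + κ * Real.pi / A) * (‖θin - θin'‖ ^ 2 + kernelDist V W) := by
    have h7 : 0 ≤ κ * Real.pi / A * ‖θin - θin'‖ ^ 2 := by positivity
    have h8 : κ * Real.pi * kernelDist V W / A = κ * Real.pi / A * kernelDist V W := by ring
    rw [h8]
    linarith
  calc ‖θ t - θ' t‖ ^ 2 ≤
      Real.exp (A * t) * (‖θin - θin'‖ ^ 2 + κ * Real.pi * kernelDist V W / A) := by linarith
    _ ≤ Real.exp (A * τ) * ((1 + κ * Real.pi / A) * (‖θin - θin'‖ ^ 2 + kernelDist V W)) := by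
      gcongr
    _ = _ := by rw [stabilityConst]; ring

/-- The mean of the difference of two solutions does not grow. -/
theorem IsSolution.mean_sub_sq_le (hα : 0 ≤ α ∧ α < 1) (hV : IsAdmissible K V)
    (hW : IsAdmissible K W) (hθ : IsSolution α κ V (fun _ => ν) θin T θ)
    (hθ' : IsSolution α κ W (fun _ => ν) θin' T θ') {t : ℝ} (ht : t ∈ timeInterval T) :
    (inner ℝ oneL2 (θ t - θ' t) : ℝ) ^ 2 ≤ ‖θin - θin'‖ ^ 2 := by
  have hsub := Icc_subset_timeInterval le_rfl ht
  have hd : ∀ r ∈ Set.Ioo 0 t,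
      HasDerivAt (fun t => (inner ℝ oneL2 (θ t - θ' t) : ℝ)) 0 r := by
    intro r hr
    obtain ⟨v, hv, hd⟩ := hθ.equation r (hsub ⟨hr.1.le, hr.2.le⟩) hr.1
    obtain ⟨v', hv', hd'⟩ := hθ'.equation r (hsub ⟨hr.1.le, hr.2.le⟩) hr.1
    refine ((innerSL ℝ oneL2).hasFDerivAt.comp_hasDerivAt r (hd.sub hd')).congr_deriv ?_
    rw [innerSL_apply_apply, inner_sub_right, inner_oneL2, inner_oneL2,
      integral_velocity hα hV (Lp.memLp (θ r)).1 hv,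
      integral_velocity hα hW (Lp.memLp (θ' r)).1 hv', sub_self]
  have hanti : AntitoneOn (fun t => (inner ℝ oneL2 (θ t - θ' t) : ℝ) ^ 2) (Set.Icc 0 t) := by
    have hd2 : ∀ r ∈ Set.Ioo 0 t,
        HasDerivAt (fun t => (inner ℝ oneL2 (θ t - θ' t) : ℝ) ^ 2) 0 r := fun r hr =>
      ((hd r hr).pow 2).congr_deriv (by simp)
    refine antitoneOn_of_deriv_nonpos (convex_Icc 0 t) ?_ ?_ ?_
    · exact ((innerSL ℝ oneL2).continuous.comp_continuousOn
        ((hθ.continuousOn.mono hsub).sub (hθ'.continuousOn.mono hsub))).pow 2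
    · rw [interior_Icc]
      exact fun r hr => (hd2 r hr).differentiableAt.differentiableWithinAt
    · rw [interior_Icc]
      exact fun r hr => (hd2 r hr).deriv.le
  have h := hanti ⟨le_rfl, ht.1⟩ ⟨ht.1, le_rfl⟩ ht.1
  simp only [hθ.initial, hθ'.initial] at h
  refine h.trans ?_
  have h1 := abs_real_inner_le_norm oneL2 (θin - θin')
  rw [norm_oneL2, one_mul] at h1
  rw [← sq_abs]
  gcongr

/-- Contraction of the distance of two solutions that stay in the region of strong
monotonicity. -/
theorem IsSolution.norm_sub_sq_le_of_small {d t₀ : ℝ} (hα : 0 ≤ α ∧ α < 1) (hκ : 0 < κ)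
    (hd : d ^ 2 ≤ 1 - α) (hd0 : 0 ≤ d) (hV : IsAdmissible K V) (hW : IsAdmissible K W)
    (hθ : IsSolution α κ V (fun _ => ν) θin T θ) (hθ' : IsSolution α κ W (fun _ => ν) θin' T θ')
    (ht₀ : 0 ≤ t₀) {t : ℝ} (ht : t ∈ timeInterval T) (ht₀t : t₀ ≤ t)
    (hsmall : ∀ r ∈ Set.Icc t₀ t, ∀ᵐ p ∂squareMeasure, |θ r p.2 - θ r p.1| ≤ d)
    (hsmall' : ∀ r ∈ Set.Icc t₀ t, ∀ᵐ p ∂squareMeasure, |θ' r p.2 - θ' r p.1| ≤ d) :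
    ‖θ t - θ' t‖ ^ 2 ≤ ‖θ t₀ - θ' t₀‖ ^ 2 + ‖θin - θin'‖ ^ 2
      + 2 * Real.pi / (1 - α) * kernelDist V W := by
  have hsub := Icc_subset_timeInterval ht₀ ht
  have hk := kernelDist_nonneg V W
  have hpi := Real.pi_pos
  have hα1 : 0 < 1 - α := by linarith [hα.2]
  set a := κ * (1 - α) with ha_def
  have ha : 0 < a := by positivity
  -- Only the variance is dissipated. The squared mean, at most the initial squared distance, is
  -- moved into the constant forcing B.
  have hgr := gronwall_of_interior (f := fun t => ‖θ t - θ' t‖ ^ 2) (A := -a)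
    (B := a * ‖θin - θin'‖ ^ 2 + 2 * κ * Real.pi * kernelDist V W) (by linarith) ht₀t
    (((hθ.continuousOn.mono hsub).sub (hθ'.continuousOn.mono hsub)).norm.pow 2) (by
      intro r hr
      have hrm := hsub ⟨hr.1.le, hr.2.le⟩
      have hr0 : 0 < r := ht₀.trans_lt hr.1
      obtain ⟨v, hv, hd⟩ := hθ.equation r hrm hr0
      obtain ⟨v', hv', hd'⟩ := hθ'.equation r hrm hr0
      refine ⟨_, (hd.sub hd').norm_sq, ?_⟩
      have h1 := integral_mul_velocity_sub_le_of_small hα ‹d ^ 2 ≤ 1 - α› hd0 hκ hV hW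
        (Lp.memLp (θ r)) (Lp.memLp (θ' r)) (Lp.memLp v) (Lp.memLp v') hv hv'
        (hsmall r ⟨hr.1.le, hr.2.le⟩) (hsmall' r ⟨hr.1.le, hr.2.le⟩)
      rw [← inner_sub_sub_eq_integral, ← norm_sub_sq_eq_integral,
        ← inner_oneL2_sub_eq_integral] at h1
      have h2 := mul_le_mul_of_nonneg_left (hθ.mean_sub_sq_le hα hV hW hθ' hrm) ha.le
      simp only [Pi.sub_apply]
      rw [ha_def] at h2 ⊢
      linarith)
  have hB : (a * ‖θin - θin'‖ ^ 2 + 2 * κ * Real.pi * kernelDist V W) / -a =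
      -(‖θin - θin'‖ ^ 2 + 2 * Real.pi / (1 - α) * kernelDist V W) := by
    rw [ha_def]; field_simp
  simp only [hB] at hgr
  have hX : 0 ≤ ‖θin - θin'‖ ^ 2 + 2 * Real.pi / (1 - α) * kernelDist V W := by positivity
  have he1 : Real.exp (-a * (t - t₀)) ≤ 1 := by
    rw [Real.exp_le_one_iff]
    nlinarith
  have he0 := Real.exp_pos (-a * (t - t₀))
  have h3 : Real.exp (-a * (t - t₀)) * ‖θ t₀ - θ' t₀‖ ^ 2 ≤ ‖θ t₀ - θ' t₀‖ ^ 2 :=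
    mul_le_of_le_one_left (sq_nonneg _) he1
  have h4 := mul_nonneg he0.le hX
  nlinarith

end Stability

/-! ### Uniform-in-time bound and the graph limit -/

/-- From x ≤ e^x. It yields an explicit waiting time without a logarithm. -/
theorem mul_exp_neg_div_le {D d : ℝ} (hD : 0 < D) (hd : 0 < d) : D * Real.exp (-(D / d)) ≤ d := by
  rw [Real.exp_neg, ← div_eq_mul_inv, div_le_iff₀ (Real.exp_pos _)]
  have h := Real.add_one_le_exp (D / d)
  calc D = d * (D / d) := by field_simp
    _ ≤ d * Real.exp (D / d) := by
      gcongr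
      linarith

/-- Uniform-in-time stability for data of diameter less than `π`. -/
theorem exists_uniform_stability {α κ K D : ℝ} (hα : 0 ≤ α ∧ α < 1) (hκ : 0 < κ)
    (hD : 0 < D ∧ D < Real.pi) :
    ∃ C, 0 < C ∧ ∀ (ν : ℝ) (V W : ℝ → ℝ → ℝ) (T : ℝ≥0∞) (θin θin' : L2) (θ θ' : ℝ → L2),
      IsAdmissible K V → IsAdmissible K W → diameter θin ≤ ENNReal.ofReal D →
      diameter θin' ≤ ENNReal.ofReal D → IsSolution α κ V (fun _ => ν) θin T θ →
      IsSolution α κ W (fun _ => ν) θin' T θ' → ∀ t ∈ timeInterval T,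
        ‖θ t - θ' t‖ ^ 2 ≤ C * (‖θin - θin'‖ ^ 2 + kernelDist V W) := by
  have hpi := Real.pi_pos
  have hα1 : 0 < 1 - α := by linarith [hα.2]
  -- Any b strictly between D and π works; the gap pays for the quadratic error in the decay of the
  -- diameter.
  set b := (D + Real.pi) / 2 with hb
  have hDb : D < b := by linarith [hD.2]
  have hbpi : b < Real.pi := by linarith [hD.2]
  set c := κ * alignRate b with hc
  have hc0 : 0 < c := mul_pos hκ (alignRate_pos (hD.1.trans hDb) hbpi)
  set d := Real.sqrt (1 - α)
  have hd0 : 0 < d := Real.sqrt_pos.2 hα1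
  have hd2 : d ^ 2 ≤ 1 - α := (Real.sq_sqrt hα1.le).le
  set t₀ := D / d / c with ht₀
  have ht₀0 : 0 ≤ t₀ := by have := hD.1; positivity
  have hS := stabilityConst_pos (K := K) t₀ hκ
  -- The three summands come from the growth up to t₀, the conserved mean of the difference, and the
  -- kernel error during the contraction.
  refine ⟨stabilityConst κ K t₀ + 1 + 2 * Real.pi / (1 - α), by positivity, ?_⟩
  intro ν V W T θin θin' θ θ' hV hW hdiam hdiam' hθ hθ' t ht
  have hk := kernelDist_nonneg V W
  have hX : 0 ≤ ‖θin - θin'‖ ^ 2 + kernelDist V W := by positivity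
  have hq : 0 ≤ 2 * Real.pi / (1 - α) := by positivity
  rcases le_total t t₀ with h | h
  · refine (hθ.norm_sub_sq_le hα hκ hV hW hθ' ht h).trans ?_
    gcongr
    linarith
  · have hsmall : ∀ r, t₀ ≤ r → D * Real.exp (-(c * r)) ≤ d := by
      intro r hr
      refine le_trans ?_ (mul_exp_neg_div_le hD.1 hd0)
      have h1 : D / d = c * t₀ := by rw [ht₀]; field_simp
      rw [h1]
      have := hD.1
      gcongr
    have hsub := Icc_subset_timeInterval ht₀0 ht
    have h1 := hθ.norm_sub_sq_le_of_small hα hκ hd2 hd0.le hV hW hθ' ht₀0 ht h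
      (fun r hr => by
        filter_upwards [hθ.diameter_decay hα hκ hD.1 hDb hbpi hV hdiam (hsub hr)] with p hp
        exact hp.trans (hsmall r hr.1))
      (fun r hr => by
        filter_upwards [hθ'.diameter_decay hα hκ hD.1 hDb hbpi hW hdiam' (hsub hr)] with p hp
        exact hp.trans (hsmall r hr.1))
    have h2 := hθ.norm_sub_sq_le hα hκ hV hW hθ' (hsub ⟨le_rfl, h⟩) le_rfl
    have h3 := mul_nonneg hq (sq_nonneg ‖θin - θin'‖)
    linarith

theorem diameter_congr {u v : ℝ → ℝ} (h : u =ᵐ[unitMeasure] v) : diameter u = diameter v := by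
  refine essSup_congr_ae ?_
  filter_upwards [Measure.quasiMeasurePreserving_fst.ae h,
    Measure.quasiMeasurePreserving_snd.ae h] with p h1 h2
  rw [h1, h2]

theorem diameter_stepL2 {N : ℕ} (a : Fin N → ℝ) :
    diameter (stepL2 a) = diameter (stepFun a) :=
  diameter_congr (MemLp.coeFn_toLp (memLp_stepFun a))

/-- The error bound, for finite and infinite time horizons. -/
theorem exists_graph_limit_const {α β κ D₀ : ℝ} (hα : 0 ≤ α ∧ α < 1) (hβ : 0 ≤ β ∧ β < 1)
    (hκ : 0 < κ) (hD₀ : 0 < D₀ ∧ D₀ < Real.pi) (T : ℝ≥0∞) :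
    ∃ C, 0 < C ∧ ∀ (ν : ℝ) (θin : L2) (N : ℕ) (a : Fin N → ℝ) (θ θN : ℝ → L2), 1 ≤ N →
      diameter θin ≤ ENNReal.ofReal D₀ →
      (T = ∞ → diameter (stepFun a) ≤ ENNReal.ofReal D₀) →
      IsSolution α κ (weight β) (fun _ => ν) θin T θ →
      IsSolution α κ (stepKernel N (weight β)) (fun _ => ν) (stepL2 a) T θN →
      ∀ t ∈ timeInterval T, ‖θN t - θ t‖ ^ 2 ≤
        C * (‖stepL2 a - θin‖ ^ 2 + kernelDist (stepKernel N (weight β)) (weight β)) := by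
  have hW := isAdmissible_weight hβ
  by_cases hT : T = ∞
  · obtain ⟨C, hC, h⟩ := exists_uniform_stability (K := weightBound β) hα hκ hD₀
    refine ⟨C, hC, fun ν θin N a θ θN hN hdiam hdiamN hθ hθN => ?_⟩
    exact h ν _ _ T _ _ _ _ (isAdmissible_stepKernel hN hW) hW
      ((diameter_stepL2 a).trans_le (hdiamN hT)) hdiam hθN hθ
  · refine ⟨stabilityConst κ (weightBound β) T.toReal, stabilityConst_pos _ hκ, ?_⟩
    intro ν θin N a θ θN hN _ _ hθ hθN t ht
    exact hθN.norm_sub_sq_le hα hκ (isAdmissible_stepKernel hN hW) hW hθ ht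
      ((ENNReal.ofReal_le_iff_le_toReal hT).1 ht.2.le)

end SCKM

end

theorem corollary4p1 (α β κ D₀ : ℝ) (hα : 0 ≤ α ∧ α < 1) (hβ : 0 ≤ β ∧ β < 1) (hκ : 0 < κ)
    (hD₀ : 0 < D₀ ∧ D₀ < Real.pi) (T : ℝ≥0∞) (hT : 0 < T) :
    ∃ C : ℝ, 0 < C ∧
      ∀ (νstar : ℝ) (θin : SCKM.L2) (a : (N : ℕ) → Fin N → ℝ)
        (θ : ℝ → SCKM.L2) (θN : ℕ → ℝ → SCKM.L2),
        SCKM.diameter θin ≤ ENNReal.ofReal D₀ →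
        Tendsto (fun N => SCKM.stepL2 (a N)) atTop (𝓝 θin) →
        (T = ∞ → ∀ N, 1 ≤ N → SCKM.diameter (SCKM.stepFun (a N)) ≤ ENNReal.ofReal D₀) →
        SCKM.IsSolution α κ (SCKM.weight β) (fun _ => νstar) θin T θ →
        (∀ N, 1 ≤ N → SCKM.IsSolution α κ (SCKM.stepKernel N (SCKM.weight β)) (fun _ => νstar)
          (SCKM.stepL2 (a N)) T (θN N)) →
        (∀ N, 1 ≤ N → ∀ t ∈ SCKM.timeInterval T,
          ‖θN N t - θ t‖ ^ 2 ≤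
            C * (‖SCKM.stepL2 (a N) - θin‖ ^ 2
              + SCKM.kernelDist (SCKM.stepKernel N (SCKM.weight β)) (SCKM.weight β))) ∧
        TendstoUniformlyOn θN θ atTop (SCKM.timeInterval T) := by
  obtain ⟨C, hC, h⟩ := SCKM.exists_graph_limit_const hα hβ hκ hD₀ T
  refine ⟨C, hC, fun νstar θin a θ θN hdiam hlim hdiamN hθ hθN => ?_⟩
  have hbound : ∀ N, 1 ≤ N → ∀ t ∈ SCKM.timeInterval T, ‖θN N t - θ t‖ ^ 2 ≤
      C * (‖SCKM.stepL2 (a N) - θin‖ ^ 2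
        + SCKM.kernelDist (SCKM.stepKernel N (SCKM.weight β)) (SCKM.weight β)) := fun N hN =>
    h νstar θin N (a N) θ (θN N) hN hdiam (fun hT => hdiamN hT N hN) hθ (hθN N hN)
  refine ⟨hbound, ?_⟩
  have hlim1 : Tendsto (fun N => ‖SCKM.stepL2 (a N) - θin‖ ^ 2) atTop (𝓝 0) := by
    simpa using (tendsto_iff_norm_sub_tendsto_zero.1 hlim).pow 2
  have hlim2 := (hlim1.add (SCKM.tendsto_kernelDist_stepKernel
    (SCKM.isAdmissible_weight hβ).integrable)).const_mul C
  rw [add_zero, mul_zero] at hlim2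
  rw [Metric.tendstoUniformlyOn_iff]
  intro ε hε
  -- The right-hand side of the error bound does not involve t, so once it is below ε² the distance
  -- is below ε at all times.
  filter_upwards [hlim2.eventually (gt_mem_nhds (by positivity : 0 < ε ^ 2)),
    eventually_ge_atTop 1] with N h1 h2 t ht
  rw [dist_comm, dist_eq_norm]
  exact lt_of_pow_lt_pow_left₀ 2 hε.le ((hbound N h2 t ht).trans_lt h1)
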